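/- For a real number $X \ge 3$ let $P$ be a prime drawn uniformly at random from the (nonempty, finite) set of primes in $[X,2X]$, and let $G_X = P^+ - P$, where $P^+$ denotes the least prime greater than $P$. (1) There is an absolute constant $C>0$ such that for all real $X \ge 3$ and all finite sets $S$ of integers $h$ with $1 \le h \le 2X$, $$\Pr[G_X \in S] \le C\,\frac{|S|\,\log\log(3X)}{\log X}.$$ (2) Consequently, for every fixed $c \in (0,1)$, the property PSI-W$(c)$ holds, that is, $$\sup_{\substack{S \subseteq \mathbb{N} \\ |S| \le (\log X)^c}} \Pr[G_X \in S] \longrightarrow 0 \qquad (X \to \infty).$$ -/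

import Mathlib

namespace PrimeGaps

/-- The set of primes `p` with `X ≤ p ≤ 2X`, for a real number `X`. -/
def dyadicPrimes (X : ℝ) : Set ℕ := {p : ℕ | p.Prime ∧ X ≤ (p : ℝ) ∧ (p : ℝ) ≤ 2 * X}

/-- The least prime greater than `p`. -/
noncomputable def nextPrime (p : ℕ) : ℕ := sInf {q : ℕ | q.Prime ∧ p < q}

theorem nextPrime_spec (p : ℕ) : (nextPrime p).Prime ∧ p < nextPrime p := by
  have h : {q : ℕ | q.Prime ∧ p < q}.Nonempty := by
    obtain ⟨q, h1, h2⟩ := Nat.exists_infinite_primes (p + 1)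
    exact ⟨q, h2, h1⟩
  exact Nat.sInf_mem h

/-- The gap after `p`. The subtraction does not truncate, because `p < nextPrime p`. -/
noncomputable def gap (p : ℕ) : ℕ := nextPrime p - p

/-- The law of a prime drawn uniformly at random from the primes in `[X, 2X]`. -/
noncomputable def primeLaw (X : ℝ) : MeasureTheory.Measure ℕ :=
  ProbabilityTheory.uniformOn (dyadicPrimes X)

theorem dyadicPrimes_finite (X : ℝ) : (dyadicPrimes X).Finite :=
  (Set.finite_Iic ⌊2 * X⌋₊).subset fun _ hp => Nat.le_floor hp.2.2

theorem dyadicPrimes_nonempty {X : ℝ} (hX : 1 ≤ X) : (dyadicPrimes X).Nonempty := by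
  obtain ⟨p, hp, h1, h2⟩ := Nat.exists_prime_lt_and_le_two_mul ⌊X⌋₊ (by
    have := Nat.le_floor (α := ℝ) (n := 1) (by simpa using hX)
    omega)
  refine ⟨p, hp, ((Nat.floor_lt (by linarith)).1 h1).le, ?_⟩
  have h3 : (p : ℝ) ≤ 2 * (⌊X⌋₊ : ℝ) := by exact_mod_cast h2
  linarith [Nat.floor_le (show 0 ≤ X by linarith)]

theorem primeLaw_isProbabilityMeasure {X : ℝ} (hX : 1 ≤ X) :
    MeasureTheory.IsProbabilityMeasure (primeLaw X) :=
  ProbabilityTheory.isProbabilityMeasure_uniformOn (dyadicPrimes_finite X)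
    (dyadicPrimes_nonempty hX)

/-- The probability that the gap after a uniformly random prime in `[X, 2X]` lies in `S`. -/
noncomputable def gapProb (X : ℝ) (S : Finset ℕ) : ℝ := (primeLaw X).real {p : ℕ | gap p ∈ S}

/-- The largest probability with which the gap after a uniformly random prime in `[X, 2X]` lies
in a set of at most `(log X) ^ c` natural numbers. For `X ≥ 1` the family is nonempty (it contains
the empty set) and bounded above by `1`, so the supremum is a genuine one. -/
noncomputable def maxMenuProb (c X : ℝ) : ℝ :=
  ⨆ S : {S : Finset ℕ // (S.card : ℝ) ≤ Real.log X ^ c}, gapProb X S.1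

/-- Sparse-set anti-concentration with exponent `c`. -/
def PSIW (c : ℝ) : Prop := Filter.Tendsto (maxMenuProb c) Filter.atTop (nhds 0)

end PrimeGaps

/-! If the gap after `p` lies in `S`, then `p + h` is prime for some `h ∈ S`, so a union bound
reduces everything to counting primes `p` in `[X, 2X]` with `p + h` prime. Odd `h` contributes
nothing. For even `h` the Selberg sieve gives a count `≪ (h / φ h) * X / (log X)^2`, where `h / φ h
≪ log log (3X)` because `h ≤ 2X`. Dividing by the Chebyshev bound `≫ X / log X` for the number of
primes in `[X, 2X]` yields (1).

The sieve bound is `BoundingSieve.siftedSum_le_selberg`; its error term is crude, which only costs a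
small power of `X` in the sieve level. The dependence on `h` enters through `sq_log_le_selbergSum`,
which bounds the Selberg sum below by `(log w)^2 / 4` divided by `h / φ h`. The bound on `h / φ h`
is `primeFactorRatio_le`, by comparison with the Euler product of zeta at `1 + δ`. The prime count
is `card_primes_Ioc_ge`, from Erdős's analysis of the central binomial coefficient.

For (2), Bertrand's postulate confines gaps to `[1, 2X]`, so an arbitrary `S` may be trimmed to that
range, and `(log X)^(c - 1) * log log (3X)` tends to `0`. -/

/-! ### The Selberg upper bound sieve -/

open ArithmeticFunction.Moebius in
theorem ArithmeticFunction.sum_divisors_moebius (k : ℕ) :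
    ∑ e ∈ k.divisors, (μ e : ℝ) = if k = 1 then 1 else 0 := by
  have h : ((μ : ArithmeticFunction ℝ) * (ArithmeticFunction.zeta : ArithmeticFunction ℝ)) k =
      (1 : ArithmeticFunction ℝ) k := by
    rw [ArithmeticFunction.coe_moebius_mul_coe_zeta]
  rw [ArithmeticFunction.coe_mul_zeta_apply, ArithmeticFunction.one_apply] at h
  simpa using h

-- Writing `d = l * e`, squarefreeness makes `l` and `e` coprime, so `μ l` factors out and a full
-- Möbius sum over the divisors of `m / l` remains. This inversion diagonalises the Selberg
-- quadratic form.
open ArithmeticFunction.Moebius in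
theorem ArithmeticFunction.sum_divisors_filter_dvd_moebius {m : ℕ} (hm : Squarefree m) (l : ℕ) :
    ∑ d ∈ m.divisors with l ∣ d, (μ d : ℝ) = if l = m then (μ l : ℝ) else 0 := by
  by_cases hlm : l ∣ m
  swap
  · rw [if_neg (by rintro rfl; exact hlm dvd_rfl)]
    refine Finset.sum_eq_zero fun d hd => ?_
    obtain ⟨hd, hld⟩ := Finset.mem_filter.1 hd
    exact absurd (hld.trans (Nat.dvd_of_mem_divisors hd)) hlm
  obtain ⟨k, rfl⟩ := hlm
  have hl0 : l ≠ 0 := left_ne_zero_of_mul hm.ne_zero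
  have hk0 : k ≠ 0 := right_ne_zero_of_mul hm.ne_zero
  have key : ∑ d ∈ (l * k).divisors with l ∣ d, (μ d : ℝ) =
      ∑ e ∈ k.divisors, (μ l : ℝ) * (μ e : ℝ) := by
    symm
    refine Finset.sum_bij (fun e _ => l * e) ?_ ?_ ?_ ?_
    · intro e he
      simp only [Finset.mem_filter, Nat.mem_divisors]
      exact ⟨⟨mul_dvd_mul_left l (Nat.dvd_of_mem_divisors he), hm.ne_zero⟩, dvd_mul_right _ _⟩
    · intro a _ b _ h
      exact Nat.eq_of_mul_eq_mul_left (Nat.pos_of_ne_zero hl0) h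
    · intro d hd
      simp only [Finset.mem_filter, Nat.mem_divisors] at hd
      obtain ⟨⟨hd, -⟩, e, rfl⟩ := hd
      exact ⟨e, Nat.mem_divisors.2 ⟨(Nat.mul_dvd_mul_iff_left (Nat.pos_of_ne_zero hl0)).1 hd, hk0⟩,
        rfl⟩
    · intro e he
      have hsq : Squarefree (l * e) :=
        hm.squarefree_of_dvd (mul_dvd_mul_left l (Nat.dvd_of_mem_divisors he))
      rw [ArithmeticFunction.isMultiplicative_moebius.map_mul_of_coprime
        (Nat.coprime_of_squarefree_mul hsq)]
      push_cast; ring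
  rw [key, ← Finset.mul_sum, ArithmeticFunction.sum_divisors_moebius]
  by_cases hk : k = 1
  · simp [hk]
  · rw [if_neg hk, if_neg, mul_zero]
    intro h
    exact hk (Nat.eq_of_mul_eq_mul_left (Nat.pos_of_ne_zero hl0) (by rw [← h, mul_one]))

namespace BoundingSieve

open ArithmeticFunction.Moebius

/-- The divisors of the sifting product that are at most `z`. -/
def boundedDivisors (s : BoundingSieve) (z : ℕ) : Finset ℕ := {l ∈ s.prodPrimes.divisors | l ≤ z}

/-- The denominator in the main term of the Selberg sieve. -/
noncomputable def selbergSum (s : BoundingSieve) (z : ℕ) : ℝ :=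
  ∑ l ∈ s.boundedDivisors z, s.selbergTerms l

/-- The optimal weights in the Selberg sieve. -/
noncomputable def selbergWeights (s : BoundingSieve) (z d : ℕ) : ℝ :=
  μ d * (s.nu d)⁻¹ * (s.selbergSum z)⁻¹ *
    ∑ l ∈ s.boundedDivisors z with d ∣ l, s.selbergTerms l

variable {s : BoundingSieve} {z : ℕ}

theorem mem_boundedDivisors {l : ℕ} : l ∈ s.boundedDivisors z ↔ l ∣ s.prodPrimes ∧ l ≤ z := by
  simp [boundedDivisors, prodPrimes_ne_zero]

theorem selbergTerms_pos_of_mem {l : ℕ} (hl : l ∈ s.boundedDivisors z) : 0 < s.selbergTerms l :=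
  selbergTerms_pos (mem_boundedDivisors.1 hl).1

theorem selbergSum_pos (hz : 1 ≤ z) : 0 < s.selbergSum z :=
  Finset.sum_pos (fun _ hl => selbergTerms_pos_of_mem hl)
    ⟨1, mem_boundedDivisors.2 ⟨one_dvd _, hz⟩⟩

theorem selbergWeights_one (hz : 1 ≤ z) : s.selbergWeights z 1 = 1 := by
  have := (selbergSum_pos (s := s) hz).ne'
  simp only [selbergWeights, ArithmeticFunction.moebius_apply_one, s.nu_mult.map_one, one_dvd,
    Finset.filter_true]
  change _ * _ * _ * s.selbergSum z = 1
  simp [this]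

theorem selbergWeights_eq_zero {d : ℕ} (hd : z < d) : s.selbergWeights z d = 0 := by
  rw [selbergWeights, Finset.sum_eq_zero, mul_zero]
  intro l hl
  obtain ⟨hl, hdl⟩ := Finset.mem_filter.1 hl
  obtain ⟨hlP, hlz⟩ := mem_boundedDivisors.1 hl
  have := Nat.le_of_dvd (Nat.pos_of_ne_zero (squarefree_of_dvd_prodPrimes hlP).ne_zero) hdl
  omega

/-- The sum over multiples of `d` is part of `selbergSum`. The classical bound is `1`; this weaker
one suffices because the error term may lose any fixed power of `z`. -/
theorem abs_selbergWeights_le (hz : 1 ≤ z) {d : ℕ} (hd : d ∣ s.prodPrimes) :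
    |s.selbergWeights z d| ≤ (s.nu d)⁻¹ := by
  have hG := selbergSum_pos (s := s) hz
  have hnu := nu_pos_of_dvd_prodPrimes hd
  have hsum0 : 0 ≤ ∑ l ∈ s.boundedDivisors z with d ∣ l, s.selbergTerms l :=
    Finset.sum_nonneg fun l hl => (selbergTerms_pos_of_mem (Finset.mem_filter.1 hl).1).le
  have hsum : ∑ l ∈ s.boundedDivisors z with d ∣ l, s.selbergTerms l ≤ s.selbergSum z :=
    Finset.sum_le_sum_of_subset_of_nonneg (Finset.filter_subset _ _)
      fun l hl _ => (selbergTerms_pos_of_mem hl).le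
  have hmu : |(μ d : ℝ)| ≤ 1 := by exact_mod_cast ArithmeticFunction.abs_moebius_le_one
  rw [selbergWeights, abs_mul, abs_mul, abs_mul, abs_of_pos (inv_pos.2 hG), abs_of_nonneg hsum0,
    abs_of_pos (inv_pos.2 hnu)]
  calc |(μ d : ℝ)| * (s.nu d)⁻¹ * (s.selbergSum z)⁻¹ * _
      ≤ 1 * (s.nu d)⁻¹ * (s.selbergSum z)⁻¹ * s.selbergSum z := by gcongr
    _ = (s.nu d)⁻¹ := by field_simp

/-- These sums are the variables in which the main term is diagonal, and the weights are built by
dual Möbius inversion to give them their optimal values. -/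
theorem sum_nu_mul_selbergWeights {l : ℕ} (hl : l ∣ s.prodPrimes) :
    (∑ d ∈ s.prodPrimes.divisors, if l ∣ d then s.nu d * s.selbergWeights z d else 0) =
      if l ≤ z then μ l * s.selbergTerms l * (s.selbergSum z)⁻¹ else 0 := by
  calc (∑ d ∈ s.prodPrimes.divisors, if l ∣ d then s.nu d * s.selbergWeights z d else 0)
      = ∑ d ∈ s.prodPrimes.divisors, ∑ m ∈ s.boundedDivisors z,
          if l ∣ d ∧ d ∣ m then μ d * s.selbergTerms m * (s.selbergSum z)⁻¹ else 0 := by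
        refine Finset.sum_congr rfl fun d hd => ?_
        have hnu := nu_ne_zero (Nat.dvd_of_mem_divisors hd)
        split_ifs with h
        · simp only [h, true_and]
          rw [← Finset.sum_filter, selbergWeights, Finset.mul_sum, Finset.mul_sum]
          refine Finset.sum_congr rfl fun m _ => ?_
          field_simp
        · simp [h]
    _ = ∑ m ∈ s.boundedDivisors z, ∑ d ∈ m.divisors with l ∣ d,
          μ d * s.selbergTerms m * (s.selbergSum z)⁻¹ := by
        rw [Finset.sum_comm]
        refine Finset.sum_congr rfl fun m hm => ?_
        rw [← Finset.sum_filter]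
        refine Finset.sum_congr ?_ fun _ _ => rfl
        have hmP := (mem_boundedDivisors.1 hm).1
        ext d
        simp only [Finset.mem_filter, Nat.mem_divisors]
        exact ⟨fun h => ⟨⟨h.2.2, (squarefree_of_dvd_prodPrimes hmP).ne_zero⟩, h.2.1⟩,
          fun h => ⟨⟨h.1.1.trans hmP, prodPrimes_ne_zero⟩, h.2, h.1.1⟩⟩
    _ = ∑ m ∈ s.boundedDivisors z,
          if l = m then μ l * s.selbergTerms m * (s.selbergSum z)⁻¹ else 0 := by
        refine Finset.sum_congr rfl fun m hm => ?_
        have hmP := (mem_boundedDivisors.1 hm).1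
        simp_rw [mul_assoc]
        rw [← Finset.sum_mul, ArithmeticFunction.sum_divisors_filter_dvd_moebius
          (squarefree_of_dvd_prodPrimes hmP)]
        split_ifs <;> simp
    _ = _ := by
        rw [Finset.sum_ite_eq]
        simp [mem_boundedDivisors, hl]

theorem mainSum_selbergWeights (hz : 1 ≤ z) :
    s.mainSum (lambdaSquared (s.selbergWeights z)) = (s.selbergSum z)⁻¹ := by
  have hG := (selbergSum_pos (s := s) hz).ne'
  rw [mainSum_lambdaSquared_eq_sum_mul_sum_sq]
  calc _ = ∑ l ∈ s.prodPrimes.divisors,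
        if l ≤ z then s.selbergTerms l * (s.selbergSum z)⁻¹ ^ 2 else 0 := by
        refine Finset.sum_congr rfl fun l hl => ?_
        have hlP := Nat.dvd_of_mem_divisors hl
        rw [sum_nu_mul_selbergWeights hlP]
        have hg := (selbergTerms_pos hlP).ne'
        have hmu : (μ l : ℝ) ^ 2 = 1 := by
          exact_mod_cast ArithmeticFunction.moebius_sq_eq_one_of_squarefree
            (squarefree_of_dvd_prodPrimes hlP)
        split_ifs
        · rw [mul_pow, mul_pow, hmu]; field_simp
        · simp
    _ = _ := by
        rw [← Finset.sum_filter, ← Finset.sum_mul]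
        change s.selbergSum z * _ = _
        field_simp

/-- Each pair `(d1, d2)` contributes only at `d = lcm d1 d2`. At most `z ^ 2` pairs have nonzero
weights; each weight is at most `z` and each remainder at most `z ^ 2`. -/
theorem errSum_selbergWeights_le (hz : 1 ≤ z)
    (hnu : ∀ d, d ∣ s.prodPrimes → (s.nu d)⁻¹ ≤ d)
    (hrem : ∀ d, d ∣ s.prodPrimes → |s.rem d| ≤ d) :
    s.errSum (lambdaSquared (s.selbergWeights z)) ≤ (z : ℝ) ^ 6 := by
  set w := s.selbergWeights z with hw
  set D := s.prodPrimes.divisors with hD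
  have hwle : ∀ d ∈ D, |w d| ≤ if d ≤ z then (z : ℝ) else 0 := by
    intro d hd
    have hdP := Nat.dvd_of_mem_divisors hd
    split_ifs with h
    · exact (abs_selbergWeights_le hz hdP).trans ((hnu d hdP).trans (by exact_mod_cast h))
    · rw [hw, selbergWeights_eq_zero (not_le.1 h), abs_zero]
  calc s.errSum (lambdaSquared w)
      ≤ ∑ d ∈ D, ∑ d1 ∈ D, ∑ d2 ∈ D,
          if d = d1.lcm d2 then |w d1| * |w d2| * |s.rem d| else 0 := by
        refine Finset.sum_le_sum fun d hd => ?_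
        have hdP := Nat.mem_divisors.1 hd
        have hsub : d.divisors ⊆ D := Nat.divisors_subset_of_dvd hdP.2 hdP.1
        have hnn : ∀ d1 d2, 0 ≤ if d = d1.lcm d2 then |w d1| * |w d2| else 0 := by
          intro d1 d2; split_ifs <;> positivity
        calc |lambdaSquared w d| * |s.rem d|
            ≤ (∑ d1 ∈ d.divisors, ∑ d2 ∈ d.divisors,
                if d = d1.lcm d2 then |w d1| * |w d2| else 0) * |s.rem d| := by
              gcongr
              refine (Finset.abs_sum_le_sum_abs _ _).trans (Finset.sum_le_sum fun d1 _ => ?_)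
              refine (Finset.abs_sum_le_sum_abs _ _).trans (Finset.sum_le_sum fun d2 _ => ?_)
              split_ifs <;> simp [abs_mul]
          _ ≤ (∑ d1 ∈ D, ∑ d2 ∈ D,
                if d = d1.lcm d2 then |w d1| * |w d2| else 0) * |s.rem d| := by
              gcongr
              refine (Finset.sum_le_sum fun d1 _ => Finset.sum_le_sum_of_subset_of_nonneg hsub
                fun d2 _ _ => hnn d1 d2).trans ?_
              exact Finset.sum_le_sum_of_subset_of_nonneg hsub
                fun d1 _ _ => Finset.sum_nonneg fun d2 _ => hnn d1 d2
          _ = _ := by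
              simp_rw [Finset.sum_mul, ite_mul, zero_mul]
    _ = ∑ d1 ∈ D, ∑ d2 ∈ D, |w d1| * |w d2| * |s.rem (d1.lcm d2)| := by
        rw [Finset.sum_comm]
        refine Finset.sum_congr rfl fun d1 hd1 => ?_
        rw [Finset.sum_comm]
        refine Finset.sum_congr rfl fun d2 hd2 => ?_
        have hmem : d1.lcm d2 ∈ D := Nat.mem_divisors.2 ⟨Nat.lcm_dvd
          (Nat.dvd_of_mem_divisors hd1) (Nat.dvd_of_mem_divisors hd2), prodPrimes_ne_zero⟩
        rw [Finset.sum_ite_eq' D (d1.lcm d2) fun d => |w d1| * |w d2| * |s.rem d|, if_pos hmem]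
    _ ≤ ∑ d1 ∈ D, ∑ d2 ∈ D,
          (if d1 ≤ z then (z : ℝ) ^ 2 else 0) * (if d2 ≤ z then (z : ℝ) ^ 2 else 0) := by
        refine Finset.sum_le_sum fun d1 hd1 => Finset.sum_le_sum fun d2 hd2 => ?_
        have hlcm : d1.lcm d2 ∣ s.prodPrimes := Nat.lcm_dvd
          (Nat.dvd_of_mem_divisors hd1) (Nat.dvd_of_mem_divisors hd2)
        have h1 := hwle d1 hd1
        have h2 := hwle d2 hd2
        by_cases h1z : d1 ≤ z
        · by_cases h2z : d2 ≤ z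
          · rw [if_pos h1z] at h1 ⊢
            rw [if_pos h2z] at h2 ⊢
            have h3 : |s.rem (d1.lcm d2)| ≤ (z : ℝ) * z := by
              refine (hrem _ hlcm).trans ?_
              have : d1.lcm d2 ≤ d1 * d2 := Nat.le_of_dvd (Nat.mul_pos
                (Nat.pos_of_mem_divisors hd1) (Nat.pos_of_mem_divisors hd2)) (Nat.lcm_dvd_mul _ _)
              exact_mod_cast this.trans (Nat.mul_le_mul h1z h2z)
            calc |w d1| * |w d2| * |s.rem (d1.lcm d2)| ≤ (z : ℝ) * z * (z * z) := by gcongr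
              _ = _ := by ring
          · rw [if_neg h2z] at h2
            rw [le_antisymm h2 (abs_nonneg _)]
            simp [h2z]
        · rw [if_neg h1z] at h1
          rw [le_antisymm h1 (abs_nonneg _)]
          simp [h1z]
    _ = (∑ d ∈ D, if d ≤ z then (z : ℝ) ^ 2 else 0) ^ 2 := by
        rw [← Finset.sum_mul_sum, ← sq]
    _ ≤ ((z : ℝ) * z ^ 2) ^ 2 := by
        gcongr
        rw [← Finset.sum_filter, Finset.sum_const, nsmul_eq_mul]
        gcongr
        have hsub : D.filter (· ≤ z) ⊆ Finset.Icc 1 z := fun d hd => by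
          obtain ⟨hd, hdz⟩ := Finset.mem_filter.1 hd
          exact Finset.mem_Icc.2 ⟨Nat.pos_of_mem_divisors hd, hdz⟩
        simpa using Finset.card_le_card hsub
    _ = (z : ℝ) ^ 6 := by ring

/-- The **Selberg upper bound sieve**, with a crude treatment of the error term. -/
theorem siftedSum_le_selberg (hz : 1 ≤ z)
    (hnu : ∀ d, d ∣ s.prodPrimes → (s.nu d)⁻¹ ≤ d)
    (hrem : ∀ d, d ∣ s.prodPrimes → |s.rem d| ≤ d) :
    s.siftedSum ≤ s.totalMass / s.selbergSum z + (z : ℝ) ^ 6 := by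
  refine (siftedSum_le_mainSum_errSum_of_upperMoebius (s := s) _
    (upperMoebius_lambdaSquared _ (selbergWeights_one (s := s) hz))).trans ?_
  rw [mainSum_selbergWeights hz, ← div_eq_mul_inv]
  gcongr
  exact errSum_selbergWeights_le hz hnu hrem

end BoundingSieve

/-! ### Sieving `n * (n + h)`: local densities and remainders -/

namespace PrimeGaps

/-- The number of residues `r` modulo `d` with `d ∣ r * (r + h)`. -/
noncomputable def pairRootCount (h d : ℕ) : ℕ := Nat.card {r : ZMod d // r * (r + h) = 0}

theorem pairRootCount_one (h : ℕ) : pairRootCount h 1 = 1 := by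
  rw [pairRootCount, Nat.card_eq_one_iff_unique]
  exact ⟨⟨fun a b => Subtype.ext (Subsingleton.elim _ _)⟩, ⟨⟨0, by simp⟩⟩⟩

theorem pairRootCount_mul (h : ℕ) {m n : ℕ} (hmn : m.Coprime n) :
    pairRootCount h (m * n) = pairRootCount h m * pairRootCount h n := by
  rw [pairRootCount, pairRootCount, pairRootCount, ← Nat.card_prod]
  let e := ZMod.chineseRemainder hmn
  refine Nat.card_congr ((e.toEquiv.subtypeEquiv (q := fun c : ZMod m × ZMod n =>
    c.1 * (c.1 + h) = 0 ∧ c.2 * (c.2 + h) = 0) fun r => ?_).trans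
      (Equiv.subtypeProdEquivProd (p := fun r : ZMod m => r * (r + h) = 0)
        (q := fun r : ZMod n => r * (r + h) = 0)))
  have h1 : e (r * (r + h)) = e r * (e r + (h : ZMod m × ZMod n)) := by simp
  rw [← map_eq_zero_iff e e.injective, h1, Prod.ext_iff]
  simp

theorem pairRootCount_pos (h : ℕ) {d : ℕ} (hd : d ≠ 0) : 0 < pairRootCount h d := by
  have : NeZero d := ⟨hd⟩
  have : Nonempty {r : ZMod d // r * (r + h) = 0} := ⟨⟨0, by simp⟩⟩
  exact Nat.card_pos

theorem pairRootCount_prime_of_dvd {h p : ℕ} (hp : p.Prime) (hph : p ∣ h) :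
    pairRootCount h p = 1 := by
  have : Fact p.Prime := ⟨hp⟩
  have h0 : (h : ZMod p) = 0 := (ZMod.natCast_eq_zero_iff h p).2 hph
  rw [pairRootCount, Nat.card_eq_one_iff_unique]
  refine ⟨⟨fun a b => Subtype.ext ?_⟩, ⟨⟨0, by simp⟩⟩⟩
  have ha : (a : ZMod p) = 0 := by simpa [h0] using a.2
  have hb : (b : ZMod p) = 0 := by simpa [h0] using b.2
  rw [ha, hb]

theorem pairRootCount_prime_of_not_dvd {h p : ℕ} (hp : p.Prime) (hph : ¬p ∣ h) :
    pairRootCount h p = 2 := by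
  have : Fact p.Prime := ⟨hp⟩
  have h0 : (h : ZMod p) ≠ 0 := fun h0 => hph ((ZMod.natCast_eq_zero_iff h p).1 h0)
  have hset : {r : ZMod p | r * (r + h) = 0} = {0, -(h : ZMod p)} := by
    ext r
    simp [add_eq_zero_iff_eq_neg]
  have : pairRootCount h p = Set.ncard {r : ZMod p | r * (r + h) = 0} := rfl
  rw [this, hset, Set.ncard_pair]
  intro h1
  exact h0 (neg_eq_zero.1 h1.symm)

/-- The multiplicative function giving the density of the `n` with `d ∣ n * (n + h)`. -/
noncomputable def pairDensity (h : ℕ) : ArithmeticFunction ℝ :=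
  ⟨fun d => pairRootCount h d / d, by simp⟩

theorem pairDensity_apply (h d : ℕ) : pairDensity h d = pairRootCount h d / d := rfl

theorem pairDensity_isMultiplicative (h : ℕ) : (pairDensity h).IsMultiplicative := by
  refine ⟨by simp [pairDensity_apply, pairRootCount_one], fun {m n} hmn => ?_⟩
  simp only [pairDensity_apply, pairRootCount_mul h hmn]
  push_cast
  rw [mul_div_mul_comm]

theorem pairDensity_prime_of_dvd {h p : ℕ} (hp : p.Prime) (hph : p ∣ h) :
    pairDensity h p = 1 / p := by
  rw [pairDensity_apply, pairRootCount_prime_of_dvd hp hph, Nat.cast_one]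

theorem pairDensity_prime_of_not_dvd {h p : ℕ} (hp : p.Prime) (hph : ¬p ∣ h) :
    pairDensity h p = 2 / p := by
  rw [pairDensity_apply, pairRootCount_prime_of_not_dvd hp hph, Nat.cast_ofNat]

theorem pairDensity_prime_pos (h : ℕ) {p : ℕ} (hp : p.Prime) : 0 < pairDensity h p := by
  rw [pairDensity_apply]
  have := pairRootCount_pos h hp.ne_zero
  have := hp.pos
  positivity

/-- Evenness of `h` matters exactly at `p = 2`: for odd `h` every `n * (n + h)` is even and the
density there is `1`. -/
theorem pairDensity_prime_lt_one {h p : ℕ} (hh : Even h) (hp : p.Prime) : pairDensity h p < 1 := by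
  have hp0 : (0 : ℝ) < p := by exact_mod_cast hp.pos
  by_cases hph : p ∣ h
  · rw [pairDensity_prime_of_dvd hp hph, div_lt_one hp0]
    exact_mod_cast hp.one_lt
  · rw [pairDensity_prime_of_not_dvd hp hph, div_lt_one hp0]
    have h2 : p ≠ 2 := by rintro rfl; exact hph hh.two_dvd
    have := hp.two_le
    exact_mod_cast (show 2 < p by omega)

theorem inv_pairDensity_le (h d : ℕ) (hd : d ≠ 0) : (pairDensity h d)⁻¹ ≤ d := by
  have h1 : (1 : ℝ) ≤ pairRootCount h d := by exact_mod_cast pairRootCount_pos h hd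
  rw [pairDensity_apply, inv_div]
  exact div_le_self (by positivity) h1

theorem count_dvd_mul_add (h d : ℕ) (hd : d ≠ 0) :
    Nat.count (fun n => d ∣ n * (n + h)) d = pairRootCount h d := by
  have : NeZero d := ⟨hd⟩
  rw [Nat.count_eq_card_filter_range]
  classical
  rw [pairRootCount, Nat.card_eq_fintype_card, Fintype.card_subtype]
  refine Finset.card_bij' (fun n _ => (n : ZMod d)) (fun r _ => r.val) ?_ ?_ ?_ ?_
  · intro n hn
    obtain ⟨-, hn⟩ := Finset.mem_filter.1 hn
    refine Finset.mem_filter.2 ⟨Finset.mem_univ _, ?_⟩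
    have := (ZMod.natCast_eq_zero_iff (n * (n + h)) d).2 hn
    push_cast at this
    exact this
  · intro r hr
    obtain ⟨-, hr⟩ := Finset.mem_filter.1 hr
    refine Finset.mem_filter.2 ⟨Finset.mem_range.2 (ZMod.val_lt r), ?_⟩
    rw [← ZMod.natCast_eq_zero_iff]
    push_cast
    rw [ZMod.natCast_zmod_val]
    exact hr
  · intro n hn
    exact ZMod.val_cast_of_lt (Finset.mem_range.1 (Finset.mem_filter.1 hn).1)
  · intro r _
    exact ZMod.natCast_zmod_val r

theorem card_filter_Ico_mul_of_periodic (a d q : ℕ) (p : ℕ → Prop) [DecidablePred p]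
    (hp : Function.Periodic p d) :
    ((Finset.Ico a (a + d * q)).filter p).card = q * Nat.count p d := by
  induction q with
  | zero => simp
  | succ q ih =>
    have hunion : Finset.Ico a (a + d * (q + 1)) =
        Finset.Ico a (a + d * q) ∪ Finset.Ico (a + d * q) (a + d * q + d) := by
      rw [Finset.Ico_union_Ico_eq_Ico (by omega) (by omega)]
      rw [mul_add, mul_one, add_assoc]
    rw [hunion, Finset.filter_union, Finset.card_union_of_disjoint
      (Finset.disjoint_filter_filter (Finset.Ico_disjoint_Ico_consecutive _ _ _)), ih,
      Nat.filter_Ico_card_eq_of_periodic _ _ _ hp]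
    ring

/-- Full periods are counted exactly; the leftover block has length `L % d`, and both the true and
the expected count on it lie between `0` and that length. -/
theorem abs_card_filter_Ico_sub_le_of_periodic (a d L : ℕ) (hd : d ≠ 0) (p : ℕ → Prop)
    [DecidablePred p] (hp : Function.Periodic p d) :
    |(((Finset.Ico a (a + L)).filter p).card : ℝ) - (Nat.count p d : ℝ) / d * L| ≤ d := by
  set c := Nat.count p d with hc
  have hcd : c ≤ d := Nat.count_le p
  have hd0 : (0 : ℝ) < d := by exact_mod_cast Nat.pos_of_ne_zero hd
  have hL := Nat.div_add_mod L d
  have ht := (Nat.mod_lt L (Nat.pos_of_ne_zero hd)).le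
  set q := L / d
  set t := L % d
  have hlow : q * c ≤ ((Finset.Ico a (a + L)).filter p).card := by
    rw [← card_filter_Ico_mul_of_periodic a d q p hp]
    exact Finset.card_le_card (Finset.filter_subset_filter _
      (Finset.Ico_subset_Ico_right (by omega)))
  have hupp : ((Finset.Ico a (a + L)).filter p).card ≤ q * c + t := by
    have hunion : Finset.Ico a (a + L) =
        Finset.Ico a (a + d * q) ∪ Finset.Ico (a + d * q) (a + L) := by
      rw [Finset.Ico_union_Ico_eq_Ico (by omega) (by omega)]
    rw [hunion, Finset.filter_union]
    refine (Finset.card_union_le _ _).trans ?_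
    rw [card_filter_Ico_mul_of_periodic a d q p hp]
    gcongr
    refine (Finset.card_filter_le _ _).trans ?_
    rw [Nat.card_Ico]
    omega
  have hlow' : (q : ℝ) * c ≤ ((Finset.Ico a (a + L)).filter p).card := by exact_mod_cast hlow
  have hupp' : (((Finset.Ico a (a + L)).filter p).card : ℝ) ≤ q * c + t := by exact_mod_cast hupp
  have hmain : (c : ℝ) / d * L = q * c + c * t / d := by
    rw [← hL]; push_cast; field_simp
  have htd : (t : ℝ) ≤ d := by exact_mod_cast ht
  have hct : (c : ℝ) * t / d ≤ t := by
    rw [div_le_iff₀ hd0, mul_comm]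
    gcongr
  have hct0 : 0 ≤ (c : ℝ) * t / d := by positivity
  rw [hmain, abs_le]
  constructor <;> linarith

/-- The sieve of the values `n * (n + h)` for `a ≤ n < a + L` by the primes up to `w`. -/
noncomputable def pairSieve {h : ℕ} (hh : Even h) (a L w : ℕ) : BoundingSieve where
  support := (Finset.Ico a (a + L)).image fun n => n * (n + h)
  prodPrimes := primorial w
  prodPrimes_squarefree := squarefree_primorial w
  weights := fun _ => 1
  weights_nonneg := fun _ => zero_le_one
  totalMass := L
  nu := pairDensity h
  nu_mult := pairDensity_isMultiplicative h
  nu_pos_of_prime := fun _ hp _ => pairDensity_prime_pos h hp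
  nu_lt_one_of_prime := fun _ hp _ => pairDensity_prime_lt_one hh hp

/-- The support of `pairSieve` is an image; injectivity ensures that its unit weights count each `n`
once. -/
theorem strictMono_mul_add_self (h : ℕ) : StrictMono fun n : ℕ => n * (n + h) := by
  intro m n hmn
  dsimp only
  nlinarith

theorem abs_rem_pairSieve_le {h : ℕ} (hh : Even h) (a L w : ℕ) {d : ℕ} (hd : d ≠ 0) :
    |(pairSieve hh a L w).rem d| ≤ d := by
  have hper : Function.Periodic (fun n => d ∣ n * (n + h)) d := by
    intro n
    have : (n + d) * (n + d + h) = n * (n + h) + d * (2 * n + d + h) := by ring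
    simp only [this]
    exact propext (Nat.dvd_add_left (dvd_mul_right _ _))
  have h1 := abs_card_filter_Ico_sub_le_of_periodic a d L hd _ hper
  rw [count_dvd_mul_add h d hd, ← pairDensity_apply] at h1
  convert h1 using 2
  rw [BoundingSieve.rem, BoundingSieve.multSum]
  simp only [pairSieve]
  rw [Finset.sum_image (strictMono_mul_add_self h).injective.injOn, ← Finset.sum_filter]
  simp

/-- The condition `w < n` keeps the primes `n` and `n + h` themselves out of the sifting product. -/
theorem card_le_siftedSum_pairSieve {h : ℕ} (hh : Even h) (a L w : ℕ) :
    (((Finset.Ico a (a + L)).filter fun n => w < n ∧ n.Prime ∧ (n + h).Prime).card : ℝ) ≤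
      (pairSieve hh a L w).siftedSum := by
  have hsum : (pairSieve hh a L w).siftedSum =
      ∑ d ∈ (Finset.Ico a (a + L)).image fun n => n * (n + h),
        if (primorial w).Coprime d then (1 : ℝ) else 0 := rfl
  rw [hsum, Finset.sum_image (strictMono_mul_add_self h).injective.injOn, ← Finset.sum_filter]
  simp only [Finset.sum_const, nsmul_eq_mul, mul_one, Nat.cast_le]
  refine Finset.card_le_card fun n hn => ?_
  obtain ⟨hn, hwn, h1, h2⟩ := Finset.mem_filter.1 hn
  refine Finset.mem_filter.2 ⟨hn, Nat.Coprime.mul_right ?_ ?_⟩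
  · rw [Nat.coprime_comm, h1.coprime_iff_not_dvd, h1.dvd_primorial_iff]
    omega
  · rw [Nat.coprime_comm, h2.coprime_iff_not_dvd, h2.dvd_primorial_iff]
    omega

theorem card_prime_pairs_le {h : ℕ} (hh : Even h) (a L : ℕ) {w z : ℕ} (hz : 1 ≤ z) :
    (((Finset.Ico a (a + L)).filter fun n => w < n ∧ n.Prime ∧ (n + h).Prime).card : ℝ) ≤
      L / (pairSieve hh a L w).selbergSum z + (z : ℝ) ^ 6 := by
  refine (card_le_siftedSum_pairSieve hh a L w).trans
    (BoundingSieve.siftedSum_le_selberg (s := pairSieve hh a L w) hz ?_ ?_)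
  · intro d hd
    exact inv_pairDensity_le h d (ne_zero_of_dvd_ne_zero BoundingSieve.prodPrimes_ne_zero hd)
  · intro d hd
    exact abs_rem_pairSieve_le hh a L w
      (ne_zero_of_dvd_ne_zero BoundingSieve.prodPrimes_ne_zero hd)

/-! ### Lower bound for the Selberg sum -/

/-- The squarefree positive integers up to `w` that no element of `T` divides. -/
def squarefreeAvoiding (w : ℕ) (T : Finset ℕ) : Finset ℕ :=
  {n ∈ Finset.Icc 1 w | Squarefree n ∧ ∀ p ∈ T, ¬p ∣ n}

theorem mem_squarefreeAvoiding {w : ℕ} {T : Finset ℕ} {n : ℕ} :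
    n ∈ squarefreeAvoiding w T ↔ (1 ≤ n ∧ n ≤ w) ∧ Squarefree n ∧ ∀ p ∈ T, ¬p ∣ n := by
  simp [squarefreeAvoiding]

theorem totient_pos_real {n : ℕ} (hn : 1 ≤ n) : (0 : ℝ) < n.totient := by
  exact_mod_cast Nat.totient_pos.2 hn

/-- A multiple of `p` is `p * m` with `m` avoiding `p` and `φ (p * m) = (p - 1) * φ m`, so restoring
these terms costs a factor of at most `1 + 1 / (p - 1)`. -/
theorem sum_squarefreeAvoiding_le_insert (w : ℕ) (T : Finset ℕ) {p : ℕ} (hp : p.Prime) :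
    ∑ n ∈ squarefreeAvoiding w T, (1 : ℝ) / n.totient ≤
      (p / (p - 1) : ℝ) * ∑ n ∈ squarefreeAvoiding w (insert p T), (1 : ℝ) / n.totient := by
  have hp1 : (0 : ℝ) < p - 1 := sub_pos.2 (by exact_mod_cast hp.one_lt)
  rw [← Finset.sum_filter_add_sum_filter_not (squarefreeAvoiding w T) (p ∣ ·)]
  have hnot : (squarefreeAvoiding w T).filter (¬p ∣ ·) = squarefreeAvoiding w (insert p T) := by
    ext n
    simp only [Finset.mem_filter, mem_squarefreeAvoiding, Finset.mem_insert, forall_eq_or_imp]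
    tauto
  have hdvd : ∑ n ∈ squarefreeAvoiding w T with p ∣ n, (1 : ℝ) / n.totient ≤
      (1 / (p - 1) : ℝ) * ∑ n ∈ squarefreeAvoiding w (insert p T), (1 : ℝ) / n.totient := by
    have hsub : (squarefreeAvoiding w T).filter (p ∣ ·) ⊆
        (squarefreeAvoiding w (insert p T)).image (p * ·) := by
      intro n hn
      obtain ⟨hn, m, rfl⟩ := Finset.mem_filter.1 hn
      obtain ⟨⟨h1, h2⟩, hsq, hT⟩ := mem_squarefreeAvoiding.1 hn
      refine Finset.mem_image.2 ⟨m, mem_squarefreeAvoiding.2 ⟨⟨?_, ?_⟩, ?_, ?_⟩, rfl⟩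
      · exact Nat.pos_of_ne_zero (by rintro rfl; simp at h1)
      · exact (Nat.le_mul_of_pos_left m hp.pos).trans h2
      · exact hsq.squarefree_of_dvd (dvd_mul_left _ _)
      · intro q hq
        rcases Finset.mem_insert.1 hq with rfl | hq
        · exact (hp.coprime_iff_not_dvd).1 (Nat.coprime_of_squarefree_mul hsq)
        · exact fun hqm => hT q hq (hqm.mul_left p)
    refine (Finset.sum_le_sum_of_subset_of_nonneg hsub fun _ _ _ => by positivity).trans ?_
    rw [Finset.sum_image fun a _ b _ hab => Nat.eq_of_mul_eq_mul_left hp.pos hab, Finset.mul_sum]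
    refine (Finset.sum_congr rfl fun m hm => ?_).le
    have hpm := (mem_squarefreeAvoiding.1 hm).2.2 p (Finset.mem_insert_self p T)
    rw [Nat.totient_mul ((hp.coprime_iff_not_dvd).2 hpm), Nat.totient_prime hp]
    push_cast [Nat.cast_sub hp.one_le]
    rw [one_div_mul_one_div]
  rw [hnot]
  refine (add_le_add_left hdvd _).trans (le_of_eq ?_)
  field_simp
  ring

theorem sum_squarefreeAvoiding_empty_le (w : ℕ) (T : Finset ℕ) (hT : ∀ p ∈ T, p.Prime) :
    ∑ n ∈ squarefreeAvoiding w ∅, (1 : ℝ) / n.totient ≤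
      (∏ p ∈ T, (p / (p - 1) : ℝ)) * ∑ n ∈ squarefreeAvoiding w T, (1 : ℝ) / n.totient := by
  induction T using Finset.induction_on with
  | empty => simp
  | insert p T hpT ih =>
    have hT' : ∀ q ∈ T, q.Prime := fun q hq => hT q (Finset.mem_insert_of_mem hq)
    refine (ih hT').trans ?_
    rw [Finset.prod_insert hpT, mul_comm (p / (p - 1) : ℝ), mul_assoc]
    refine mul_le_mul_of_nonneg_left
      (sum_squarefreeAvoiding_le_insert w T (hT p (Finset.mem_insert_self p T))) ?_
    refine Finset.prod_nonneg fun q hq => div_nonneg (by positivity) (sub_nonneg.2 ?_)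
    exact_mod_cast (hT' q hq).one_le

/-- The product of `p / (p - 1)` over the prime divisors `p` of `n`, that is `n / φ n`. -/
noncomputable def primeFactorRatio (n : ℕ) : ℝ := ∏ p ∈ n.primeFactors, (p / (p - 1) : ℝ)

theorem one_le_prime_ratio {p : ℕ} (hp : p.Prime) : (1 : ℝ) ≤ p / (p - 1) := by
  have hp1 : (0 : ℝ) < p - 1 := sub_pos.2 (by exact_mod_cast hp.one_lt)
  rw [le_div_iff₀ hp1]
  linarith

theorem primeFactorRatio_pos (n : ℕ) : 0 < primeFactorRatio n :=
  Finset.prod_pos fun _ hp =>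
    zero_lt_one.trans_le (one_le_prime_ratio (Nat.prime_of_mem_primeFactors hp))

theorem primeFactorRatio_mul_le {m n : ℕ} (hm : m ≠ 0) (hn : n ≠ 0) :
    primeFactorRatio (m * n) ≤ primeFactorRatio m * primeFactorRatio n := by
  rw [primeFactorRatio, primeFactorRatio, primeFactorRatio, Nat.primeFactors_mul hm hn,
    ← Finset.prod_union_inter]
  refine le_mul_of_one_le_right ?_ ?_
  · refine Finset.prod_nonneg fun p hp => zero_le_one.trans (one_le_prime_ratio ?_)
    rcases Finset.mem_union.1 hp with hp | hp <;> exact Nat.prime_of_mem_primeFactors hp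
  · refine Finset.prod_const_one.symm.trans_le
      (Finset.prod_le_prod (fun _ _ => zero_le_one) fun p hp => one_le_prime_ratio ?_)
    exact Nat.prime_of_mem_primeFactors (Finset.mem_inter.1 hp).1

theorem primeFactorRatio_eq {n : ℕ} (hn : n ≠ 0) : primeFactorRatio n = n / n.totient := by
  have h := Nat.totient_mul_prod_primeFactors n
  have h' : (n.totient : ℝ) * ∏ p ∈ n.primeFactors, (p : ℝ) =
      n * ∏ p ∈ n.primeFactors, ((p : ℝ) - 1) := by
    have h2 : ∏ p ∈ n.primeFactors, ((p : ℝ) - 1) =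
        ((∏ p ∈ n.primeFactors, (p - 1) : ℕ) : ℝ) := by
      push_cast
      refine Finset.prod_congr rfl fun p hp => ?_
      rw [Nat.cast_sub (Nat.prime_of_mem_primeFactors hp).one_le, Nat.cast_one]
    rw [h2, ← Nat.cast_prod, ← Nat.cast_mul, ← Nat.cast_mul, h]
  have h3 : ∏ p ∈ n.primeFactors, ((p : ℝ) - 1) ≠ 0 :=
    Finset.prod_ne_zero_iff.2 fun p hp => (sub_pos.2 (by
      exact_mod_cast (Nat.prime_of_mem_primeFactors hp).one_lt)).ne'
  have h4 := (totient_pos_real (Nat.pos_of_ne_zero hn)).ne'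
  rw [primeFactorRatio, Finset.prod_div_distrib, div_eq_div_iff h3 h4, mul_comm, h']

/-- Every `n` is `b ^ 2 * a` with `a` squarefree, and the sum of `1 / b ^ 2` is at most `2`. -/
theorem harmonic_sum_le (w : ℕ) :
    ∑ n ∈ Finset.Icc 1 w, (1 : ℝ) / n ≤ 2 * ∑ n ∈ squarefreeAvoiding w ∅, (1 : ℝ) / n := by
  have hsub : Finset.Icc 1 w ⊆ (squarefreeAvoiding w ∅ ×ˢ Finset.Icc 1 w).image
      fun x : ℕ × ℕ => x.2 ^ 2 * x.1 := by
    intro n hn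
    obtain ⟨hn1, hnw⟩ := Finset.mem_Icc.1 hn
    obtain ⟨a, b, ha, hb, hab, hsq⟩ := Nat.sq_mul_squarefree_of_pos hn1
    refine Finset.mem_image.2 ⟨(a, b), Finset.mem_product.2 ⟨mem_squarefreeAvoiding.2
      ⟨⟨ha, ?_⟩, hsq, by simp⟩, Finset.mem_Icc.2 ⟨hb, ?_⟩⟩, hab⟩
    · exact (Nat.le_of_dvd hn1 ⟨b ^ 2, by rw [← hab, mul_comm]⟩).trans hnw
    · exact (Nat.le_of_dvd hn1 ⟨b * a, by rw [← hab]; ring⟩).trans hnw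
  have hinv : ∑ b ∈ Finset.Icc 1 w, (1 : ℝ) / b ^ 2 ≤ 2 := by
    have h := sum_Ioo_inv_sq_le (α := ℝ) 0 (w + 1)
    have h2 : Finset.Ioo 0 (w + 1) = Finset.Icc 1 w := by ext; simp; omega
    rw [h2] at h
    simpa using h
  calc ∑ n ∈ Finset.Icc 1 w, (1 : ℝ) / n
      ≤ ∑ n ∈ (squarefreeAvoiding w ∅ ×ˢ Finset.Icc 1 w).image fun x : ℕ × ℕ => x.2 ^ 2 * x.1,
          (1 : ℝ) / n := Finset.sum_le_sum_of_subset_of_nonneg hsub fun _ _ _ => by positivity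
    _ ≤ ∑ x ∈ squarefreeAvoiding w ∅ ×ˢ Finset.Icc 1 w, (1 : ℝ) / ((x.2 ^ 2 * x.1 : ℕ) : ℝ) :=
        Finset.sum_image_le_of_nonneg (f := fun n : ℕ => (1 : ℝ) / n)
          fun _ _ => by positivity
    _ = (∑ b ∈ Finset.Icc 1 w, (1 : ℝ) / b ^ 2) * ∑ n ∈ squarefreeAvoiding w ∅, (1 : ℝ) / n := by
        rw [Finset.sum_product_right, Finset.sum_mul_sum]
        refine Finset.sum_congr rfl fun b _ => Finset.sum_congr rfl fun n _ => ?_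
        push_cast
        rw [one_div_mul_one_div]
    _ ≤ _ := by
        gcongr

theorem half_log_le_sum_squarefree {w : ℕ} (hw : 1 ≤ w) :
    Real.log w / 2 ≤ ∑ n ∈ squarefreeAvoiding w ∅, (1 : ℝ) / n := by
  have h1 := log_add_one_le_harmonic w
  have h2 : ((harmonic w : ℚ) : ℝ) = ∑ n ∈ Finset.Icc 1 w, (1 : ℝ) / n := by
    rw [harmonic_eq_sum_Icc]
    push_cast
    simp
  have h3 : Real.log w ≤ Real.log (w + 1 : ℕ) :=
    Real.log_le_log (by exact_mod_cast hw) (by push_cast; linarith)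
  have h4 := harmonic_sum_le w
  linarith

theorem sum_squarefree_inv_le_inv_totient (w : ℕ) :
    ∑ n ∈ squarefreeAvoiding w ∅, (1 : ℝ) / n ≤
      ∑ n ∈ squarefreeAvoiding w ∅, (1 : ℝ) / n.totient := by
  refine Finset.sum_le_sum fun n hn => ?_
  have hn1 := (mem_squarefreeAvoiding.1 hn).1.1
  have := totient_pos_real hn1
  gcongr
  exact Nat.totient_le n

/-- The indicator function of the positive integers coprime to `h`. -/
noncomputable def coprimeIndicator (h : ℕ) : ArithmeticFunction ℝ :=
  ⟨fun n => if n ≠ 0 ∧ n.Coprime h then 1 else 0, by simp⟩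

theorem coprimeIndicator_apply (h n : ℕ) :
    coprimeIndicator h n = if n ≠ 0 ∧ n.Coprime h then 1 else 0 := rfl

theorem coprimeIndicator_isMultiplicative (h : ℕ) :
    (coprimeIndicator h).IsMultiplicative := by
  refine ⟨by simp [coprimeIndicator_apply], fun {m n} _ => ?_⟩
  simp only [coprimeIndicator_apply, Nat.coprime_mul_iff_left, ne_eq, mul_eq_zero, not_or]
  split_ifs <;> first | tauto | simp

theorem selbergTerms_prime_ge {h : ℕ} (hh : Even h) (a L w : ℕ) {p : ℕ} (hp : p.Prime) :
    (1 / (p - 1) : ℝ) * (1 + coprimeIndicator h p) ≤ (pairSieve hh a L w).selbergTerms p := by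
  have hp1 : (0 : ℝ) < p - 1 := sub_pos.2 (by exact_mod_cast hp.one_lt)
  have hp0 : (0 : ℝ) < p := by exact_mod_cast hp.pos
  rw [BoundingSieve.selbergTerms_apply, hp.primeFactors, Finset.prod_singleton]
  change _ ≤ pairDensity h p * (1 - pairDensity h p)⁻¹
  rw [coprimeIndicator_apply]
  by_cases hph : p ∣ h
  · rw [if_neg fun hc => (hp.coprime_iff_not_dvd.1 hc.2) hph, pairDensity_prime_of_dvd hp hph]
    refine le_of_eq ?_
    field_simp
    simp
  · have hlt := pairDensity_prime_lt_one hh hp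
    rw [if_pos ⟨hp.ne_zero, hp.coprime_iff_not_dvd.2 hph⟩]
    rw [pairDensity_prime_of_not_dvd hp hph] at hlt ⊢
    rw [div_lt_one hp0] at hlt
    have hp2 : (0 : ℝ) < p - 2 := by linarith
    have : (2 / p : ℝ) * (1 - 2 / p : ℝ)⁻¹ = 2 / (p - 2) := by field_simp
    rw [this, div_mul_eq_mul_div, one_mul, one_add_one_eq_two]
    gcongr
    linarith

/-- The local factors are `1 / (p - 1)` when `p ∣ h` and `2 / (p - 2) ≥ 2 / (p - 1)` otherwise.
Their product contains a factor `2` for each `p ∤ h`, which counts the divisors `v` coprime to `h`;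
the sum form prepares the enumeration of pairs `(l, v)`. -/
theorem selbergTerms_ge {h : ℕ} (hh : Even h) (a L w : ℕ) {l : ℕ} (hl : Squarefree l) :
    ∑ v ∈ l.divisors with v.Coprime h, (1 : ℝ) / l.totient ≤
      (pairSieve hh a L w).selbergTerms l := by
  have hg := BoundingSieve.selbergTerms_isMultiplicative (s := pairSieve hh a L w)
  have hprod := (coprimeIndicator_isMultiplicative h).prodPrimeFactors_one_add_of_squarefree hl
  have hsum : ∑ v ∈ l.divisors with v.Coprime h, (1 : ℝ) / l.totient =
      (1 / l.totient) * ∑ v ∈ l.divisors, coprimeIndicator h v := by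
    rw [Finset.mul_sum, Finset.sum_filter]
    refine Finset.sum_congr rfl fun v hv => ?_
    simp [coprimeIndicator_apply, (Nat.pos_of_mem_divisors hv).ne']
  have htot : (1 : ℝ) / l.totient = ∏ p ∈ l.primeFactors, (1 / (p - 1) : ℝ) := by
    have h1 := primeFactorRatio_eq hl.ne_zero
    have h2 : (l : ℝ) = ∏ p ∈ l.primeFactors, (p : ℝ) := by
      rw [← Nat.cast_prod, Nat.prod_primeFactors_of_squarefree hl]
    have h3 : (l : ℝ) ≠ 0 := by exact_mod_cast hl.ne_zero
    rw [primeFactorRatio, Finset.prod_div_distrib, ← h2] at h1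
    rw [Finset.prod_div_distrib, Finset.prod_const_one]
    field_simp at h1 ⊢
    rw [h1]
  rw [hsum, ← hprod, htot, ← Finset.prod_mul_distrib,
    ← hg.prod_primeFactors hl]
  refine Finset.prod_le_prod (fun p hp => ?_) fun p hp =>
    selbergTerms_prime_ge hh a L w (Nat.prime_of_mem_primeFactors hp)
  have hp' := Nat.prime_of_mem_primeFactors hp
  have hp1 : (0 : ℝ) < p - 1 := sub_pos.2 (by exact_mod_cast hp'.one_lt)
  have : 0 ≤ coprimeIndicator h p := by rw [coprimeIndicator_apply]; split_ifs <;> norm_num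
  positivity

/-- The map `(u, v) ↦ (u * v, v)` is injective into the pairs `(l, v)` of `selbergTerms_ge`. Level
`w ^ 2` lets both `u` and `v` range up to `w`. -/
theorem sum_pairs_le_selbergSum {h : ℕ} (hh : Even h) (h0 : h ≠ 0) (a L w : ℕ) :
    ∑ u ∈ squarefreeAvoiding w ∅, ∑ v ∈ squarefreeAvoiding w (u * h).primeFactors,
      (1 : ℝ) / u.totient * (1 / v.totient) ≤ (pairSieve hh a L w).selbergSum (w ^ 2) := by
  set B := (pairSieve hh a L w).boundedDivisors (w ^ 2)
  have hB : ∀ l, l ∈ B ↔ l ∣ primorial w ∧ l ≤ w ^ 2 := fun l =>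
    BoundingSieve.mem_boundedDivisors
  have hcop : ∀ {u v : ℕ}, u ≠ 0 → (∀ p ∈ (u * h).primeFactors, ¬p ∣ v) →
      u.Coprime v ∧ v.Coprime h := by
    intro u v hu hv
    have : (u * h).Coprime v := by
      refine Nat.coprime_of_dvd fun p hp hpu hpv => ?_
      exact hv p (Nat.mem_primeFactors.2 ⟨hp, hpu, mul_ne_zero hu h0⟩) hpv
    exact ⟨this.coprime_mul_right, this.coprime_mul_left.symm⟩
  rw [Finset.sum_sigma']
  calc _ = ∑ x ∈ (squarefreeAvoiding w ∅).sigma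
          fun u => squarefreeAvoiding w (u * h).primeFactors,
          (1 : ℝ) / (x.1 * x.2).totient := by
        refine Finset.sum_congr rfl fun x hx => ?_
        obtain ⟨hu, hv⟩ := Finset.mem_sigma.1 hx
        have hu0 := (Nat.one_le_iff_ne_zero.1 (mem_squarefreeAvoiding.1 hu).1.1)
        rw [Nat.totient_mul (hcop hu0 (mem_squarefreeAvoiding.1 hv).2.2).1]
        push_cast
        rw [one_div_mul_one_div]
    _ = ∑ y ∈ ((squarefreeAvoiding w ∅).sigma
          fun u => squarefreeAvoiding w (u * h).primeFactors).image
            (fun x => (⟨x.1 * x.2, x.2⟩ : (_ : ℕ) × ℕ)), (1 : ℝ) / y.1.totient := by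
        rw [Finset.sum_image]
        rintro ⟨u, v⟩ hx ⟨u', v'⟩ _ heq
        obtain ⟨-, hv⟩ := Finset.mem_sigma.1 hx
        simp only [Sigma.mk.injEq, heq_eq_eq] at heq
        obtain ⟨h1, rfl⟩ := heq
        rw [Nat.eq_of_mul_eq_mul_right (mem_squarefreeAvoiding.1 hv).1.1 h1]
    _ ≤ ∑ y ∈ B.sigma fun l => l.divisors.filter (·.Coprime h), (1 : ℝ) / y.1.totient := by
        refine Finset.sum_le_sum_of_subset_of_nonneg ?_ fun _ _ _ => by positivity
        intro y hy
        obtain ⟨⟨u, v⟩, hx, rfl⟩ := Finset.mem_image.1 hy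
        obtain ⟨hu, hv⟩ := Finset.mem_sigma.1 hx
        obtain ⟨⟨hu1, huw⟩, husq, -⟩ := mem_squarefreeAvoiding.1 hu
        obtain ⟨⟨hv1, hvw⟩, hvsq, hvT⟩ := mem_squarefreeAvoiding.1 hv
        dsimp only at *
        obtain ⟨huv, hvh⟩ := hcop (Nat.one_le_iff_ne_zero.1 hu1) hvT
        have hdvd : ∀ {n : ℕ}, Squarefree n → n ≤ w → n ∣ primorial w := fun hn hnw =>
          hn.dvd_primorial.trans (primorial_dvd_primorial hnw)
        refine Finset.mem_sigma.2 ⟨(hB _).2 ⟨huv.mul_dvd_of_dvd_of_dvd (hdvd husq huw)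
          (hdvd hvsq hvw), ?_⟩, Finset.mem_filter.2 ⟨Nat.mem_divisors.2 ⟨dvd_mul_left _ _, ?_⟩,
            hvh⟩⟩
        · rw [sq]; exact Nat.mul_le_mul huw hvw
        · exact (Nat.mul_pos hu1 hv1).ne'
    _ = ∑ l ∈ B, ∑ v ∈ l.divisors with v.Coprime h, (1 : ℝ) / l.totient := by
        rw [Finset.sum_sigma']
    _ ≤ _ := Finset.sum_le_sum fun l hl => selbergTerms_ge hh a L w
        ((squarefree_primorial w).squarefree_of_dvd ((hB l).1 hl).1)

/-- For fixed `u`, dropping the requirement that `v` be coprime to `u * h` costs at most `(u / φ u)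
* (h / φ h)`. The first factor turns the weight `1 / φ u` into `1 / u`, so the double sum decouples
into a square. -/
theorem sq_log_le_selbergSum {h : ℕ} (hh : Even h) (h0 : h ≠ 0) (a L : ℕ) {w : ℕ} (hw : 1 ≤ w) :
    (Real.log w / 2) ^ 2 ≤ primeFactorRatio h * (pairSieve hh a L w).selbergSum (w ^ 2) := by
  have hR := primeFactorRatio_pos h
  set Q := ∑ n ∈ squarefreeAvoiding w ∅, (1 : ℝ) / n with hQ
  have hQlog : Real.log w / 2 ≤ Q := half_log_le_sum_squarefree hw
  have hlog : 0 ≤ Real.log w := Real.log_natCast_nonneg w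
  have hinner : ∀ u ∈ squarefreeAvoiding w ∅, (1 : ℝ) / u * Q ≤ primeFactorRatio h *
      ∑ v ∈ squarefreeAvoiding w (u * h).primeFactors, (1 : ℝ) / u.totient * (1 / v.totient) := by
    intro u hu
    have hu1 := (mem_squarefreeAvoiding.1 hu).1.1
    have hu0 := Nat.one_le_iff_ne_zero.1 hu1
    have hupos : (0 : ℝ) < u := by exact_mod_cast hu1
    have hphi := totient_pos_real hu1
    have h1 := sum_squarefreeAvoiding_empty_le w (u * h).primeFactors
      fun p hp => Nat.prime_of_mem_primeFactors hp
    rw [← Finset.mul_sum]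
    set V := ∑ v ∈ squarefreeAvoiding w (u * h).primeFactors, (1 : ℝ) / v.totient with hV
    have hV0 : 0 ≤ V := Finset.sum_nonneg fun _ _ => by positivity
    have h2 : Q ≤ u / u.totient * primeFactorRatio h * V := by
      refine (sum_squarefree_inv_le_inv_totient w).trans (h1.trans ?_)
      rw [← primeFactorRatio_eq hu0]
      exact mul_le_mul_of_nonneg_right (primeFactorRatio_mul_le hu0 h0) hV0
    calc (1 : ℝ) / u * Q ≤ 1 / u * (u / u.totient * primeFactorRatio h * V) := by gcongr
      _ = _ := by field_simp
  calc (Real.log w / 2) ^ 2 ≤ Q ^ 2 := by gcongr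
    _ = ∑ u ∈ squarefreeAvoiding w ∅, (1 : ℝ) / u * Q := by rw [← Finset.sum_mul, sq]
    _ ≤ _ := Finset.sum_le_sum hinner
    _ = primeFactorRatio h * _ := by rw [← Finset.mul_sum]
    _ ≤ _ := by
        gcongr
        exact sum_pairs_le_selbergSum hh h0 a L w

/-! ### The bound `h / φ h ≪ log log h` -/

theorem tsum_rpow_neg_le {δ : ℝ} (hδ : 0 < δ) :
    ∑' n : ℕ, (n : ℝ) ^ (-(1 + δ)) ≤ 1 + 1 / δ := by
  have hs : 1 < 1 + δ := by linarith
  have h1 := ZetaAsymptotics.zeta_limit_aux1 hs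
  have h2 : 0 ≤ ZetaAsymptotics.termTSum (1 + δ) :=
    tsum_nonneg fun n => ZetaAsymptotics.term_nonneg (n + 1) _
  have h3 : Summable fun n : ℕ => (n : ℝ) ^ (-(1 + δ)) :=
    Real.summable_nat_rpow.2 (by linarith)
  rw [h3.tsum_eq_zero_add]
  have h4 : ∀ n : ℕ, ((n + 1 : ℕ) : ℝ) ^ (-(1 + δ)) = 1 / (n + 1 : ℝ) ^ (1 + δ) := by
    intro n
    rw [Real.rpow_neg (by positivity), one_div]
    push_cast
    rfl
  simp_rw [h4]
  rw [Nat.cast_zero, Real.zero_rpow (by linarith), zero_add]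
  rw [add_sub_cancel_left] at h1
  nlinarith

/-- The product expands into the sum of `n ^ (-(1 + δ))` over integers built from primes dividing
`h`, a subsum of the zeta series. -/
theorem prod_primeFactors_one_sub_rpow_inv_le {δ : ℝ} (hδ : 0 < δ) (h : ℕ) :
    ∏ p ∈ h.primeFactors, (1 - (p : ℝ) ^ (-(1 + δ)))⁻¹ ≤ 1 + 1 / δ := by
  let f : ℕ →* ℝ :=
    { toFun := fun n => (n : ℝ) ^ (-(1 + δ))
      map_one' := by simp
      map_mul' := fun m n => by
        push_cast
        exact Real.mul_rpow (by positivity) (by positivity) }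
  have hf : ∀ n, f n = (n : ℝ) ^ (-(1 + δ)) := fun _ => rfl
  have hsum : Summable f := Real.summable_nat_rpow.2 (by linarith)
  have h1 := EulerProduct.prod_filter_prime_geometric_eq_tsum_factoredNumbers hsum h.primeFactors
  rw [Finset.filter_true_of_mem fun p hp => Nat.prime_of_mem_primeFactors hp] at h1
  simp_rw [hf] at h1
  rw [h1]
  refine le_trans ?_ (tsum_rpow_neg_le hδ)
  exact Summable.tsum_subtype_le (fun n : ℕ => (n : ℝ) ^ (-(1 + δ))) _
    (fun n => by positivity) hsum

/-- The ratio of the two Euler factors is `1 + (1 - exp (-δ log p)) / (p - 1)`, hence at most `1 + δ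
log p / (p - 1)`, and `p ≤ 2 * (p - 1)`. -/
theorem prime_ratio_le {δ : ℝ} (hδ : 0 < δ) {p : ℕ} (hp : p.Prime) :
    (p / (p - 1) : ℝ) ≤
      (1 - (p : ℝ) ^ (-(1 + δ)))⁻¹ * Real.exp (2 * δ * (Real.log p / p)) := by
  have hp2 : (2 : ℝ) ≤ p := by exact_mod_cast hp.two_le
  have hp0 : (0 : ℝ) < p := by linarith
  have hp1 : (0 : ℝ) < p - 1 := by linarith
  set t := (p : ℝ) ^ (-(1 + δ)) with ht
  have ht1 : t < 1 := Real.rpow_lt_one_of_one_lt_of_neg (by linarith) (by linarith)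
  have hlog : 0 ≤ Real.log p := Real.log_nonneg (by linarith)
  have hteq : t = Real.exp (-(δ * Real.log p)) / p := by
    rw [ht, neg_add, Real.rpow_add hp0, Real.rpow_neg_one, Real.rpow_def_of_pos hp0]
    rw [show Real.log p * -δ = -(δ * Real.log p) by ring]
    field_simp
  have hexp : 1 - δ * Real.log p ≤ Real.exp (-(δ * Real.log p)) := by
    have := Real.add_one_le_exp (-(δ * Real.log p))
    linarith
  rw [← div_eq_inv_mul, le_div_iff₀ (by linarith)]
  refine le_trans ?_ (Real.add_one_le_exp _)
  have h1 : (p / (p - 1) : ℝ) * (1 - t) = (p - Real.exp (-(δ * Real.log p))) / (p - 1) := by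
    rw [hteq]; field_simp
  rw [h1, div_le_iff₀ hp1]
  have h2 : 0 ≤ δ * Real.log p := by positivity
  have h3 : (1 : ℝ) ≤ 2 * ((p - 1) / p) := by
    rw [← mul_div_assoc, le_div_iff₀ hp0]; linarith
  calc (p : ℝ) - Real.exp (-(δ * Real.log p)) ≤ (p - 1) + δ * Real.log p * 1 := by linarith
    _ ≤ (p - 1) + δ * Real.log p * (2 * ((p - 1) / p)) := by gcongr
    _ = _ := by field_simp; ring

theorem sum_primeFactors_log_le {n : ℕ} (hn : n ≠ 0) :
    ∑ p ∈ n.primeFactors, Real.log p ≤ Real.log n := by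
  rw [← Real.log_prod fun p hp => by
    exact_mod_cast (Nat.prime_of_mem_primeFactors hp).ne_zero, ← Nat.cast_prod]
  refine Real.log_le_log ?_ ?_
  · exact_mod_cast Finset.prod_pos fun p hp => (Nat.prime_of_mem_primeFactors hp).pos
  · exact_mod_cast Nat.le_of_dvd (Nat.pos_of_ne_zero hn) (Nat.prod_primeFactors_dvd n)

/-- A weak Mertens estimate by double counting `log p` over pairs `p ∣ n ≤ N`: the total is at most
`N log N`, while each `p ≤ N` has at least `N / (2p)` multiples. -/
theorem sum_primes_log_div_le (N : ℕ) :
    ∑ p ∈ Finset.Icc 1 N with p.Prime, Real.log p / p ≤ 2 * Real.log N := by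
  rcases Nat.eq_zero_or_pos N with rfl | hN
  · simp
  have hN0 : (0 : ℝ) < N := by exact_mod_cast hN
  have hupp : ∑ n ∈ Finset.Icc 1 N, ∑ p ∈ n.primeFactors, Real.log p ≤ N * Real.log N := by
    calc _ ≤ ∑ n ∈ Finset.Icc 1 N, Real.log N := by
          refine Finset.sum_le_sum fun n hn => ?_
          obtain ⟨h1, h2⟩ := Finset.mem_Icc.1 hn
          refine (sum_primeFactors_log_le (Nat.one_le_iff_ne_zero.1 h1)).trans ?_
          exact Real.log_le_log (by exact_mod_cast h1) (by exact_mod_cast h2)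
      _ = _ := by simp
  have hlow : ∑ p ∈ Finset.Icc 1 N with p.Prime, Real.log p * (N / (2 * p)) ≤
      ∑ n ∈ Finset.Icc 1 N, ∑ p ∈ n.primeFactors, Real.log p := by
    calc _ ≤ ∑ p ∈ Finset.Icc 1 N with p.Prime, Real.log p *
          (((Finset.Icc 1 N).filter (p ∣ ·)).card : ℝ) := by
          refine Finset.sum_le_sum fun p hp => ?_
          obtain ⟨hpN, hp⟩ := Finset.mem_filter.1 hp
          obtain ⟨-, hpN⟩ := Finset.mem_Icc.1 hpN
          have hcard : ((Finset.Icc 1 N).filter (p ∣ ·)).card = N / p :=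
            Nat.Ioc_filter_dvd_card_eq_div N p
          have hp0 : (0 : ℝ) < p := by exact_mod_cast hp.pos
          have hle : N ≤ 2 * p * (N / p) := by
            have h1 := Nat.div_add_mod N p
            have h2 := Nat.mod_lt N hp.pos
            have h3 : 1 ≤ N / p := (Nat.one_le_div_iff hp.pos).2 hpN
            nlinarith
          rw [hcard]
          have : 0 ≤ Real.log p := Real.log_natCast_nonneg p
          gcongr
          rw [div_le_iff₀ (by positivity), mul_comm]
          exact_mod_cast hle
      _ = ∑ p ∈ Finset.Icc 1 N with p.Prime, ∑ n ∈ Finset.Icc 1 N with p ∣ n, Real.log p := by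
          refine Finset.sum_congr rfl fun p _ => ?_
          rw [Finset.sum_const, nsmul_eq_mul, mul_comm]
      _ = _ := by
          refine Finset.sum_comm' fun p n => ?_
          simp only [Finset.mem_filter, Finset.mem_Icc, Nat.mem_primeFactors]
          constructor
          · rintro ⟨⟨-, hp⟩, hn, hpn⟩
            exact ⟨⟨hp, hpn, by omega⟩, hn⟩
          · rintro ⟨⟨hp, hpn, -⟩, hn⟩
            exact ⟨⟨⟨hp.one_le, (Nat.le_of_dvd hn.1 hpn).trans hn.2⟩, hp⟩, hn, hpn⟩
  have heq : ∑ p ∈ Finset.Icc 1 N with p.Prime, Real.log p * (N / (2 * p)) =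
      (N / 2) * ∑ p ∈ Finset.Icc 1 N with p.Prime, Real.log p / p := by
    rw [Finset.mul_sum]
    refine Finset.sum_congr rfl fun p _ => ?_
    rw [mul_comm (2 : ℝ), ← div_div]
    ring
  have := heq ▸ hlow.trans hupp
  nlinarith

/-- Primes up to `y` fall under the Mertens estimate; beyond `y`, replacing `1 / p` by `1 / y`
leaves at most `log h / y ≤ 1`. -/
theorem sum_primeFactors_log_div_le {h : ℕ} (hh : h ≠ 0) {y : ℝ} (hy : 1 ≤ y)
    (hhy : Real.log h ≤ y) :
    ∑ p ∈ h.primeFactors, Real.log p / p ≤ 2 * Real.log y + 1 := by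
  have hnn : ∀ p : ℕ, 0 ≤ Real.log p / p := fun p =>
    div_nonneg (Real.log_natCast_nonneg p) (by positivity)
  rw [← Finset.sum_filter_add_sum_filter_not h.primeFactors (fun p => (p : ℝ) ≤ y)]
  refine add_le_add ?_ ?_
  · calc _ ≤ ∑ p ∈ Finset.Icc 1 ⌊y⌋₊ with p.Prime, Real.log p / p := by
          refine Finset.sum_le_sum_of_subset_of_nonneg (fun p hp => ?_) fun p _ _ => hnn p
          obtain ⟨hp, hpy⟩ := Finset.mem_filter.1 hp
          have hp := Nat.prime_of_mem_primeFactors hp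
          exact Finset.mem_filter.2 ⟨Finset.mem_Icc.2 ⟨hp.one_le, Nat.le_floor hpy⟩, hp⟩
      _ ≤ 2 * Real.log ⌊y⌋₊ := sum_primes_log_div_le _
      _ ≤ _ := by
          gcongr
          · exact_mod_cast Nat.floor_pos.2 hy
          · exact Nat.floor_le (by linarith)
  · calc _ ≤ ∑ p ∈ h.primeFactors.filter fun p : ℕ => ¬(p : ℝ) ≤ y, Real.log p / y := by
          refine Finset.sum_le_sum fun p hp => ?_
          have hpy := not_le.1 (Finset.mem_filter.1 hp).2
          have := Real.log_natCast_nonneg p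
          gcongr
      _ ≤ ∑ p ∈ h.primeFactors, Real.log p / y :=
          Finset.sum_le_sum_of_subset_of_nonneg (Finset.filter_subset _ _) fun p _ _ =>
            div_nonneg (Real.log_natCast_nonneg p) (by linarith)
      _ ≤ y / y := by
          rw [← Finset.sum_div]
          gcongr
          exact (sum_primeFactors_log_le hh).trans hhy
      _ = 1 := div_self (by linarith)

theorem primeFactorRatio_le {h : ℕ} (hh : h ≠ 0) {y : ℝ} (hy : 2 ≤ y) (hhy : Real.log h ≤ y) :
    primeFactorRatio h ≤ 3 * Real.exp 8 * Real.log y := by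
  have hlog2 : 1 / 2 < Real.log y := by
    have := Real.log_two_gt_d9
    have := Real.log_le_log two_pos hy
    linarith
  have hlog0 : 0 < Real.log y := by linarith
  -- With this `δ` the zeta factor is `O(log y)` while the exponential correction stays bounded.
  set δ := 1 / Real.log y with hδ
  have hδ0 : 0 < δ := by positivity
  have hfac : ∀ p ∈ h.primeFactors, 0 ≤ (p / (p - 1) : ℝ) := fun p hp =>
    zero_le_one.trans (one_le_prime_ratio (Nat.prime_of_mem_primeFactors hp))
  calc primeFactorRatio h
      ≤ ∏ p ∈ h.primeFactors,
          ((1 - (p : ℝ) ^ (-(1 + δ)))⁻¹ * Real.exp (2 * δ * (Real.log p / p))) :=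
        Finset.prod_le_prod hfac fun p hp =>
          prime_ratio_le hδ0 (Nat.prime_of_mem_primeFactors hp)
    _ = (∏ p ∈ h.primeFactors, (1 - (p : ℝ) ^ (-(1 + δ)))⁻¹) *
          Real.exp (2 * δ * ∑ p ∈ h.primeFactors, Real.log p / p) := by
        rw [Finset.prod_mul_distrib, ← Real.exp_sum, Finset.mul_sum]
    _ ≤ (1 + 1 / δ) * Real.exp (2 * δ * (2 * Real.log y + 1)) := by
        gcongr
        · exact prod_primeFactors_one_sub_rpow_inv_le hδ0 h
        · exact sum_primeFactors_log_div_le hh (by linarith) hhy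
    _ ≤ (3 * Real.log y) * Real.exp 8 := by
        have h1 : 1 + 1 / δ ≤ 3 * Real.log y := by rw [hδ, one_div_one_div]; linarith
        have h2 : 2 * δ * (2 * Real.log y + 1) ≤ 8 := by
          have : 2 * δ * (2 * Real.log y + 1) = 4 + 2 / Real.log y := by
            rw [hδ]; field_simp; ring
          have h3 : 2 / Real.log y ≤ 4 := by rw [div_le_iff₀ hlog0]; linarith
          linarith
        gcongr
    _ = _ := by ring

/-! ### A Chebyshev lower bound for primes in a dyadic interval -/

/-- Erdős's factorisation: primes up to `√(2n)` contribute prime powers at most `2n`, larger ones up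
to `2n / 3` divide at most once and are absorbed in a primorial, those in `(2n / 3, n]` do not
divide, and those above `n` are kept and counted. -/
theorem centralBinom_le_pow_card_primes {n : ℕ} (hn : 2 < n) :
    n.centralBinom ≤ (2 * n) ^ Nat.sqrt (2 * n) * 4 ^ (2 * n / 3) *
      (2 * n) ^ ((Finset.Ioc n (2 * n)).filter Nat.Prime).card := by
  have hn2 : 1 ≤ 2 * n := by omega
  set R := (Finset.range (2 * n + 1)).filter Nat.Prime with hR
  have hprod : n.centralBinom = ∏ p ∈ R, p ^ n.centralBinom.factorization p := by
    rw [hR]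
    conv_lhs => rw [← n.prod_pow_factorization_centralBinom]
    refine (Finset.prod_filter_of_ne fun p _ h => ?_).symm
    contrapose h
    rw [Nat.factorization_eq_zero_of_not_prime _ h, pow_zero]
  have hfac : ∀ p ∈ R, p ^ n.centralBinom.factorization p ≤
      (if p ≤ Nat.sqrt (2 * n) then 2 * n else 1) * (if p ≤ 2 * n / 3 then p else 1) *
        (if n < p then 2 * n else 1) := by
    intro p hp
    obtain ⟨hpn, hp⟩ := Finset.mem_filter.1 hp
    have hpn : p ≤ 2 * n := Nat.lt_succ_iff.1 (Finset.mem_range.1 hpn)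
    have hp1 := hp.one_le
    by_cases h1 : p ≤ Nat.sqrt (2 * n)
    · rw [if_pos h1, mul_assoc]
      refine (Nat.pow_factorization_choose_le (by omega)).trans (Nat.le_mul_of_pos_right _ ?_)
      split_ifs <;> positivity
    · have h2 : p ^ n.centralBinom.factorization p ≤ p :=
        (Nat.pow_le_pow_right hp.one_le (Nat.factorization_choose_le_one
          (Nat.sqrt_lt'.mp (not_le.1 h1)))).trans (pow_one p).le
      rw [if_neg h1, one_mul]
      by_cases h3 : p ≤ 2 * n / 3
      · rw [if_pos h3]
        refine h2.trans (Nat.le_mul_of_pos_right _ ?_)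
        split_ifs <;> positivity
      · rw [if_neg h3, one_mul]
        by_cases h4 : n < p
        · rw [if_pos h4]
          exact h2.trans hpn
        · rw [Nat.factorization_centralBinom_of_two_mul_self_lt_three_mul hn (not_lt.1 h4)
            (by omega), pow_zero]
          split_ifs
          omega
  rw [hprod]
  refine (Finset.prod_le_prod' hfac).trans ?_
  rw [Finset.prod_mul_distrib, Finset.prod_mul_distrib, ← Finset.prod_filter,
    ← Finset.prod_filter, ← Finset.prod_filter, Finset.prod_const, Finset.prod_const]
  gcongr ?_ * ?_ * ?_
  · refine Nat.pow_le_pow_right hn2 ?_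
    calc (R.filter (· ≤ Nat.sqrt (2 * n))).card ≤ (Finset.Icc 1 (Nat.sqrt (2 * n))).card := by
          refine Finset.card_le_card fun p hp => ?_
          obtain ⟨hp, h1⟩ := Finset.mem_filter.1 hp
          exact Finset.mem_Icc.2 ⟨(Finset.mem_filter.1 hp).2.one_le, h1⟩
      _ = _ := by simp
  · refine le_trans ?_ (primorial_le_four_pow (2 * n / 3))
    refine Finset.prod_le_prod_of_subset_of_one_le' (fun p hp => ?_) fun p hp _ => ?_
    · obtain ⟨hp, h1⟩ := Finset.mem_filter.1 hp
      exact Finset.mem_filter.2 ⟨Finset.mem_range.2 (Nat.lt_succ_of_le h1),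
        (Finset.mem_filter.1 hp).2⟩
    · exact (Finset.mem_filter.1 hp).2.one_le
  · refine Nat.pow_le_pow_right hn2 (Finset.card_le_card fun p hp => ?_)
    obtain ⟨hp, h1⟩ := Finset.mem_filter.1 hp
    obtain ⟨h2, hp⟩ := Finset.mem_filter.1 hp
    exact Finset.mem_filter.2 ⟨Finset.mem_Ioc.2 ⟨h1, Nat.lt_succ_iff.1 (Finset.mem_range.1 h2)⟩,
      hp⟩

theorem sqrt_add_one_mul_log_le {x : ℝ} (hx : 80 ^ 4 ≤ x) :
    (√x + 1) * Real.log x ≤ x / 10 := by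
  have hx0 : 0 < x := lt_of_lt_of_le (by norm_num) hx
  set t := √√x with ht
  -- The threshold is what `8 * t ^ 3 ≤ t ^ 4 / 10` requires.
  have ht80 : 80 ≤ t := by
    refine Real.le_sqrt_of_sq_le (Real.le_sqrt_of_sq_le ?_)
    linarith
  have ht2 : t ^ 2 = √x := Real.sq_sqrt (Real.sqrt_nonneg x)
  have ht4 : t ^ 4 = x := by
    rw [show t ^ 4 = (t ^ 2) ^ 2 by ring, ht2, Real.sq_sqrt hx0.le]
  have hlog : Real.log x ≤ 4 * t := by
    rw [← ht4, Real.log_pow]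
    have := Real.log_le_self (show 0 ≤ t by linarith)
    push_cast
    linarith
  rw [← ht2]
  calc (t ^ 2 + 1) * Real.log x ≤ (2 * t ^ 2) * (4 * t) := by
        gcongr
        · exact Real.log_nonneg (le_trans (by norm_num) hx)
        · nlinarith
    _ = 8 * t ^ 3 := by ring
    _ ≤ t ^ 3 * t / 10 := by
        have : 0 ≤ t ^ 3 := by positivity
        nlinarith
    _ = x / 10 := by rw [← ht4]; ring

/-- Taking logarithms against `4 ^ n ≤ n * centralBinom n` leaves `(n / 3) log 4 > 0.46 n`, from
which the lower-order terms remove at most `0.2 n`. -/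
theorem card_primes_Ioc_ge {n : ℕ} (hn : 80 ^ 4 ≤ n) :
    (n : ℝ) / 4 ≤ ((Finset.Ioc n (2 * n)).filter Nat.Prime).card * Real.log (2 * n) := by
  have hn0 : (0 : ℝ) < n := by exact_mod_cast (show 0 < n by omega)
  have hn1 : (1 : ℝ) ≤ n := by exact_mod_cast (show 1 ≤ n by omega)
  set K := ((Finset.Ioc n (2 * n)).filter Nat.Prime).card
  have h1 : 4 ^ n ≤ n * ((2 * n) ^ Nat.sqrt (2 * n) * 4 ^ (2 * n / 3) * (2 * n) ^ K) :=
    (Nat.four_pow_lt_mul_centralBinom n (by omega)).le.trans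
      (Nat.mul_le_mul_left n (centralBinom_le_pow_card_primes (by omega)))
  have h2 : (4 : ℝ) ^ n ≤
      n * ((2 * n) ^ Nat.sqrt (2 * n) * 4 ^ (2 * n / 3) * (2 * n) ^ K) := by
    exact_mod_cast h1
  have h3 := Real.log_le_log (by positivity) h2
  rw [Real.log_mul (by positivity) (by positivity), Real.log_mul (by positivity) (by positivity),
    Real.log_mul (by positivity) (by positivity), Real.log_pow, Real.log_pow, Real.log_pow,
    Real.log_pow] at h3
  have h4 : ((Nat.sqrt (2 * n) : ℕ) : ℝ) ≤ √(2 * n) := by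
    have := Real.nat_sqrt_le_real_sqrt (a := 2 * n)
    simpa using this
  have h5 : ((2 * n / 3 : ℕ) : ℝ) ≤ 2 * n / 3 := by
    have := Nat.cast_div_le (α := ℝ) (m := 2 * n) (n := 3)
    simpa using this
  have h6 : Real.log n ≤ Real.log (2 * n) := Real.log_le_log hn0 (by linarith)
  have h7 : 0 ≤ Real.log (2 * n) := Real.log_nonneg (by linarith)
  have hlog4 : (1.38 : ℝ) < Real.log 4 := by
    rw [show (4 : ℝ) = 2 ^ 2 by norm_num, Real.log_pow]
    have := Real.log_two_gt_d9
    push_cast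
    linarith
  have hx : (80 ^ 4 : ℝ) ≤ 2 * n := by
    have : (80 ^ 4 : ℝ) ≤ n := by exact_mod_cast hn
    linarith
  have h8 := sqrt_add_one_mul_log_le hx
  have h9 := mul_le_mul_of_nonneg_right h4 h7
  have h10 := mul_le_mul_of_nonneg_right h5 (show 0 ≤ Real.log 4 by linarith)
  have h11 := mul_lt_mul_of_pos_left hlog4 hn0
  nlinarith

theorem div_log_le_ncard_dyadicPrimes {X : ℝ} (hX : 80 ^ 4 + 1 ≤ X) :
    X / (16 * Real.log X) ≤ (dyadicPrimes X).ncard := by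
  have hX0 : 0 < X := lt_of_lt_of_le (by norm_num) hX
  set n := ⌊X⌋₊ with hn
  have hnX : (n : ℝ) ≤ X := Nat.floor_le hX0.le
  have hXn : X < n + 1 := Nat.lt_floor_add_one X
  have hn80 : 80 ^ 4 ≤ n := by
    refine Nat.le_floor ?_
    push_cast
    linarith
  have hn1 : (1 : ℝ) ≤ n := by exact_mod_cast (show 1 ≤ n by omega)
  have hlogX : 0 < Real.log X := Real.log_pos (lt_of_lt_of_le (by norm_num) hX)
  have hlog : Real.log (2 * n) ≤ 2 * Real.log X := by
    rw [two_mul (Real.log X), ← Real.log_mul hX0.ne' hX0.ne']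
    refine Real.log_le_log (by linarith) ?_
    have : (2 : ℝ) ≤ X := le_trans (by norm_num) hX
    gcongr
  have hcard : ((Finset.Ioc n (2 * n)).filter Nat.Prime).card ≤ (dyadicPrimes X).ncard := by
    rw [← Set.ncard_coe_finset]
    refine Set.ncard_le_ncard (fun p hp => ?_) (dyadicPrimes_finite X)
    obtain ⟨hp, hpp⟩ := Finset.mem_filter.1 (Finset.mem_coe.1 hp)
    obtain ⟨h1, h2⟩ := Finset.mem_Ioc.1 hp
    have h1' : (n : ℝ) + 1 ≤ p := by exact_mod_cast h1
    have h2' : (p : ℝ) ≤ 2 * n := by exact_mod_cast h2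
    exact ⟨hpp, by linarith, by linarith⟩
  have hcard' : (((Finset.Ioc n (2 * n)).filter Nat.Prime).card : ℝ) ≤
      (dyadicPrimes X).ncard := by exact_mod_cast hcard
  have hmain := card_primes_Ioc_ge hn80
  rw [div_le_iff₀ (by positivity)]
  have h3 : (((Finset.Ioc n (2 * n)).filter Nat.Prime).card : ℝ) * Real.log (2 * n) ≤
      (dyadicPrimes X).ncard * (2 * Real.log X) := by
    have : 0 ≤ Real.log (2 * n) := Real.log_nonneg (by linarith)
    gcongr
  linarith

/-! ### From prime pairs to the law of the gap -/

/-- The primes in `[X, 2X]` as a finite set. -/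
noncomputable def dyadicPrimesFinset (X : ℝ) : Finset ℕ := (dyadicPrimes_finite X).toFinset

theorem mem_dyadicPrimesFinset {X : ℝ} {p : ℕ} :
    p ∈ dyadicPrimesFinset X ↔ p.Prime ∧ X ≤ (p : ℝ) ∧ (p : ℝ) ≤ 2 * X :=
  Set.Finite.mem_toFinset _

theorem gapProb_eq (X : ℝ) (S : Finset ℕ) :
    gapProb X S = (((dyadicPrimesFinset X).filter fun p => gap p ∈ S).card : ℝ) /
      (dyadicPrimesFinset X).card := by
  have h1 : dyadicPrimes X = ((dyadicPrimesFinset X : Finset ℕ) : Set ℕ) := by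
    simp [dyadicPrimesFinset]
  have h2 : dyadicPrimes X ∩ {p | gap p ∈ S} =
      (((dyadicPrimesFinset X).filter fun p => gap p ∈ S : Finset ℕ) : Set ℕ) := by
    rw [Finset.coe_filter, h1]
    rfl
  rw [gapProb, MeasureTheory.Measure.real, primeLaw, ProbabilityTheory.uniformOn,
    ProbabilityTheory.cond_apply (Set.to_countable _).measurableSet, h2, h1,
    MeasureTheory.Measure.count_apply_finset, MeasureTheory.Measure.count_apply_finset]
  simp [ENNReal.toReal_mul, ENNReal.toReal_inv, div_eq_inv_mul]

theorem gapProb_nonneg (X : ℝ) (S : Finset ℕ) : 0 ≤ gapProb X S := by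
  rw [gapProb_eq]; positivity

theorem gapProb_le_one (X : ℝ) (S : Finset ℕ) : gapProb X S ≤ 1 := by
  rw [gapProb_eq]
  refine div_le_one_of_le₀ ?_ (by positivity)
  exact_mod_cast Finset.card_filter_le _ _

theorem gap_pos (p : ℕ) : 1 ≤ gap p := by
  have := (nextPrime_spec p).2
  rw [gap]; omega

theorem gap_le {p : ℕ} (hp : p ≠ 0) : gap p ≤ p := by
  obtain ⟨q, hq, h1, h2⟩ := Nat.exists_prime_lt_and_le_two_mul p hp
  have : nextPrime p ≤ q := Nat.sInf_le ⟨hq, h1⟩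
  rw [gap]; omega

theorem prime_add_gap (p : ℕ) : (p + gap p).Prime := by
  obtain ⟨h1, h2⟩ := nextPrime_spec p
  rw [gap, Nat.add_sub_cancel' h2.le]
  exact h1

/-- Bertrand's postulate, through `gap_le`, makes values outside `[1, 2X]` impossible. -/
theorem gapProb_eq_filter (X : ℝ) (S : Finset ℕ) :
    gapProb X S = gapProb X (S.filter fun h => 1 ≤ h ∧ (h : ℝ) ≤ 2 * X) := by
  rw [gapProb_eq, gapProb_eq]
  congr 3
  refine Finset.filter_congr fun p hp => ?_
  obtain ⟨hp, -, h2⟩ := mem_dyadicPrimesFinset.1 hp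
  have h3 : (gap p : ℝ) ≤ p := by exact_mod_cast gap_le hp.ne_zero
  simp only [Finset.mem_filter]
  exact ⟨fun h => ⟨h, gap_pos p, h3.trans h2⟩, fun h => h.1⟩

theorem card_filter_gap_le (X : ℝ) (S : Finset ℕ) :
    ((dyadicPrimesFinset X).filter fun p => gap p ∈ S).card ≤
      ∑ h ∈ S, ((dyadicPrimesFinset X).filter fun p => (p + h).Prime).card := by
  refine le_trans (Finset.card_le_card fun p hp => ?_) Finset.card_biUnion_le
  obtain ⟨hp, hg⟩ := Finset.mem_filter.1 hp
  exact Finset.mem_biUnion.2 ⟨gap p, hg, Finset.mem_filter.2 ⟨hp, prime_add_gap p⟩⟩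

theorem card_filter_prime_add_odd {X : ℝ} (hX : 3 ≤ X) {h : ℕ} (hh : ¬Even h) :
    ((dyadicPrimesFinset X).filter fun p => (p + h).Prime).card = 0 := by
  rw [Finset.card_eq_zero, Finset.filter_eq_empty_iff]
  intro p hp hph
  obtain ⟨hp, h1, -⟩ := mem_dyadicPrimesFinset.1 hp
  have h3 : 3 ≤ p := by exact_mod_cast hX.trans h1
  have hodd := hp.odd_of_ne_two (by omega)
  have heven : Even (p + h) := hodd.add_odd (Nat.not_even_iff_odd.1 hh)
  have := hph.even_iff.1 heven
  omega

theorem half_le_log_log {X : ℝ} (hX : 3 ≤ X) :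
    2 ≤ Real.log (3 * X) ∧ 1 / 2 ≤ Real.log (Real.log (3 * X)) := by
  have h1 : 2 ≤ Real.log (3 * X) := by
    rw [Real.le_log_iff_exp_le (by linarith), show (2 : ℝ) = 1 + 1 by norm_num, Real.exp_add]
    have := Real.exp_one_lt_d9
    have := Real.exp_pos 1
    nlinarith
  refine ⟨h1, ?_⟩
  have := Real.log_two_gt_d9
  have := Real.log_le_log two_pos h1
  linarith

theorem card_filter_prime_add_even_le {X : ℝ} (hX : 2 ^ 48 ≤ X) {h : ℕ} (hh : Even h)
    (h0 : h ≠ 0) (hhX : (h : ℝ) ≤ 2 * X) :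
    (((dyadicPrimesFinset X).filter fun p => (p + h).Prime).card : ℝ) ≤
      (60000 * Real.exp 8) * (X * Real.log (Real.log (3 * X)) / Real.log X ^ 2) := by
  have hX1 : 1 < X := lt_of_lt_of_le (by norm_num) hX
  have hX0 : 0 < X := by linarith
  have hX3 : 3 ≤ X := le_trans (by norm_num) hX
  obtain ⟨hy, hLL⟩ := half_le_log_log hX3
  set LL := Real.log (Real.log (3 * X)) with hLLdef
  have hlogX : 0 < Real.log X := Real.log_pos hX1
  -- With `w ≤ r ^ 2` and `z = w ^ 2`, the sieve error `z ^ 6` is at most `r ^ 24 = X ^ (1 / 2)`.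
  -- The hypothesis `2 ^ 48 ≤ X` says `r ≥ 2`, which gives `⌊r ^ 2⌋₊ ≥ r`.
  set r := X ^ (1 / 48 : ℝ) with hr
  have hr48 : r ^ 48 = X := by
    rw [hr, ← Real.rpow_natCast, ← Real.rpow_mul hX0.le]
    norm_num
  have hr0 : 0 ≤ r := by positivity
  have hr2 : 2 ≤ r := by
    by_contra hlt
    have := pow_lt_pow_left₀ (not_le.1 hlt) hr0 (show 48 ≠ 0 by norm_num)
    linarith
  have hlogr : Real.log X = 48 * Real.log r := by
    rw [← hr48, Real.log_pow]; norm_num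
  set w := ⌊r ^ 2⌋₊ with hw
  have hwle : (w : ℝ) ≤ r ^ 2 := Nat.floor_le (by positivity)
  have hwge : r ≤ w := by
    have := Nat.lt_floor_add_one (r ^ 2)
    rw [← hw] at this
    nlinarith
  have hw1 : 1 ≤ w := by
    have : (1 : ℝ) ≤ w := by linarith
    exact_mod_cast this
  have hwX : (w : ℝ) < X := by
    refine hwle.trans_lt ?_
    rw [← hr48]
    exact pow_lt_pow_right₀ (by linarith) (by norm_num)
  have hlogw : Real.log X / 48 ≤ Real.log w := by
    rw [hlogr, mul_div_cancel_left₀ _ (by norm_num)]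
    exact Real.log_le_log (by linarith) hwge
  set a := ⌈X⌉₊ with ha
  set L := ⌊2 * X⌋₊ + 1 - a with hL
  have haX : X ≤ a := Nat.le_ceil X
  have hLX : (L : ℝ) ≤ 2 * X := by
    have h1 : (⌊2 * X⌋₊ : ℝ) ≤ 2 * X := Nat.floor_le (by linarith)
    have h2 : L ≤ ⌊2 * X⌋₊ := by
      have : 1 ≤ a := Nat.one_le_ceil_iff.2 hX0
      omega
    exact le_trans (by exact_mod_cast h2) h1
  have hsub : ((dyadicPrimesFinset X).filter fun p => (p + h).Prime) ⊆
      (Finset.Ico a (a + L)).filter fun n => w < n ∧ n.Prime ∧ (n + h).Prime := by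
    intro p hp
    obtain ⟨hp, hph⟩ := Finset.mem_filter.1 hp
    obtain ⟨hp, h1, h2⟩ := mem_dyadicPrimesFinset.1 hp
    have h3 : a ≤ p := Nat.ceil_le.2 h1
    have h4 : p ≤ ⌊2 * X⌋₊ := Nat.le_floor h2
    refine Finset.mem_filter.2 ⟨Finset.mem_Ico.2 ⟨h3, by omega⟩, ?_, hp, hph⟩
    exact_mod_cast hwX.trans_le h1
  have hcard := card_prime_pairs_le hh a L (w := w) (z := w ^ 2) (Nat.one_le_pow _ _ hw1)
  have hG := sq_log_le_selbergSum hh h0 a L hw1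
  have hR : primeFactorRatio h ≤ 3 * Real.exp 8 * LL := by
    refine primeFactorRatio_le h0 hy (Real.log_le_log ?_ (by linarith))
    exact_mod_cast Nat.pos_of_ne_zero h0
  have hR0 := primeFactorRatio_pos h
  set R := primeFactorRatio h
  have hG0 : 0 < (pairSieve hh a L w).selbergSum (w ^ 2) :=
    BoundingSieve.selbergSum_pos (Nat.one_le_pow _ _ hw1)
  set G := (pairSieve hh a L w).selbergSum (w ^ 2)
  have hGX : (Real.log X / 96) ^ 2 ≤ R * G := by
    exact (pow_le_pow_left₀ (by positivity) (by linarith) 2).trans hG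
  have hmain : (L : ℝ) / G ≤ 2 * X * (3 * Real.exp 8 * LL) * 96 ^ 2 / Real.log X ^ 2 := by
    rw [div_le_div_iff₀ hG0 (by positivity)]
    calc (L : ℝ) * Real.log X ^ 2 = L * (96 ^ 2 * (Real.log X / 96) ^ 2) := by ring
      _ ≤ 2 * X * (96 ^ 2 * (R * G)) := by gcongr
      _ ≤ 2 * X * (96 ^ 2 * (3 * Real.exp 8 * LL * G)) := by gcongr
      _ = _ := by ring
  -- Here `4608 = 2 * 48 ^ 2`, from `log X ≤ 48 * r` and `LL ≥ 1 / 2`.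
  have herr : ((w ^ 2 : ℕ) : ℝ) ^ 6 ≤ 4608 * (X * LL / Real.log X ^ 2) := by
    have h1 : ((w ^ 2 : ℕ) : ℝ) ^ 6 ≤ r ^ 24 := by
      push_cast
      calc ((w : ℝ) ^ 2) ^ 6 ≤ ((r ^ 2) ^ 2) ^ 6 := by gcongr
        _ = r ^ 24 := by ring
    have h2 : Real.log X ≤ 48 * r := by
      rw [hlogr]
      have := Real.log_le_self hr0
      linarith
    refine h1.trans ?_
    rw [← mul_div_assoc, le_div_iff₀ (by positivity)]
    calc r ^ 24 * Real.log X ^ 2 ≤ r ^ 24 * (48 * r) ^ 2 := by gcongr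
      _ = 2304 * r ^ 26 := by ring
      _ ≤ 2304 * r ^ 48 := by
          have : r ^ 26 ≤ r ^ 48 := pow_le_pow_right₀ (by linarith) (by norm_num)
          linarith
      _ = 4608 * (X * (1 / 2)) := by rw [hr48]; ring
      _ ≤ 4608 * (X * LL) := by gcongr
  have hexp : (1 : ℝ) ≤ Real.exp 8 := Real.one_le_exp (by norm_num)
  have hq : 0 ≤ X * LL / Real.log X ^ 2 := by positivity
  calc (((dyadicPrimesFinset X).filter fun p => (p + h).Prime).card : ℝ)
      ≤ (((Finset.Ico a (a + L)).filter fun n => w < n ∧ n.Prime ∧ (n + h).Prime).card : ℝ) := by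
        exact_mod_cast Finset.card_le_card hsub
    _ ≤ L / G + ((w ^ 2 : ℕ) : ℝ) ^ 6 := hcard
    _ ≤ 2 * X * (3 * Real.exp 8 * LL) * 96 ^ 2 / Real.log X ^ 2 +
          4608 * (X * LL / Real.log X ^ 2) := add_le_add hmain herr
    _ = (55296 * Real.exp 8 + 4608) * (X * LL / Real.log X ^ 2) := by ring
    _ ≤ _ := by
        refine mul_le_mul_of_nonneg_right ?_ hq
        linarith

theorem gapProb_le_of_large {X : ℝ} (hX : 2 ^ 48 ≤ X) {S : Finset ℕ}
    (hS : ∀ h ∈ S, 1 ≤ h ∧ (h : ℝ) ≤ 2 * X) :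
    gapProb X S ≤ (16 * (60000 * Real.exp 8)) *
      (S.card * Real.log (Real.log (3 * X)) / Real.log X) := by
  have hX1 : 1 < X := lt_of_lt_of_le (by norm_num) hX
  have hX3 : 3 ≤ X := le_trans (by norm_num) hX
  obtain ⟨-, hLL⟩ := half_le_log_log hX3
  have hlogX : 0 < Real.log X := Real.log_pos hX1
  set LL := Real.log (Real.log (3 * X))
  set B := (60000 * Real.exp 8) * (X * LL / Real.log X ^ 2) with hB
  have hB0 : 0 ≤ B := by positivity
  have hnum : (((dyadicPrimesFinset X).filter fun p => gap p ∈ S).card : ℝ) ≤ S.card * B := by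
    calc _ ≤ ∑ h ∈ S, (((dyadicPrimesFinset X).filter fun p => (p + h).Prime).card : ℝ) := by
          exact_mod_cast card_filter_gap_le X S
      _ ≤ ∑ h ∈ S, B := by
          refine Finset.sum_le_sum fun h hh => ?_
          obtain ⟨h1, h2⟩ := hS h hh
          by_cases he : Even h
          · exact card_filter_prime_add_even_le hX he (by omega) h2
          · rw [card_filter_prime_add_odd hX3 he]
            simpa using hB0
      _ = _ := by simp
  have hden : X / (16 * Real.log X) ≤ (dyadicPrimesFinset X).card := by
    rw [dyadicPrimesFinset, ← Set.ncard_eq_toFinset_card _ (dyadicPrimes_finite X)]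
    exact div_log_le_ncard_dyadicPrimes (le_trans (by norm_num) hX)
  rw [gapProb_eq]
  calc _ ≤ S.card * B / (X / (16 * Real.log X)) := by gcongr
    _ = _ := by rw [hB]; field_simp

theorem exists_gapProb_le : ∃ C : ℝ, 0 < C ∧ ∀ X : ℝ, 3 ≤ X → ∀ S : Finset ℕ,
    (∀ h ∈ S, 1 ≤ h ∧ (h : ℝ) ≤ 2 * X) →
      gapProb X S ≤ C * ((S.card : ℝ) * Real.log (Real.log (3 * X)) / Real.log X) := by
  refine ⟨16 * (60000 * Real.exp 8), by positivity, fun X hX S hS => ?_⟩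
  by_cases hlarge : 2 ^ 48 ≤ X
  · exact gapProb_le_of_large hlarge hS
  -- For bounded `X` the trivial bound `1` suffices, but only once `S.card ≥ 1`.
  rcases S.eq_empty_or_nonempty with rfl | hne
  · simp [gapProb_eq]
  obtain ⟨-, hLL⟩ := half_le_log_log hX
  have hlog0 : 0 < Real.log X := Real.log_pos (by linarith)
  have hlog : Real.log X ≤ 48 := by
    have h1 := Real.log_le_log (by linarith) (not_le.1 hlarge).le
    rw [Real.log_pow] at h1
    have := Real.log_two_lt_d9
    push_cast at h1
    linarith
  have hcard : (1 : ℝ) ≤ S.card := by exact_mod_cast hne.card_pos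
  have hexp : (1 : ℝ) ≤ Real.exp 8 := Real.one_le_exp (by norm_num)
  refine (gapProb_le_one X S).trans ?_
  calc (1 : ℝ) ≤ (16 * (60000 * 1)) * (1 * (1 / 2) / 48) := by norm_num
    _ ≤ _ := by gcongr

/-! ### Anti-concentration on sparse sets -/

theorem psiw_of_lt_one {c : ℝ} (hc : c < 1) : PSIW c := by
  obtain ⟨C, hC, hbound⟩ := exists_gapProb_le
  have hlim : Filter.Tendsto (fun X : ℝ => C * (Real.log X ^ (-(1 - c)) * Real.log 2 +
      Real.log (Real.log X) / Real.log X ^ (1 - c))) Filter.atTop (nhds 0) := by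
    have h1 : Filter.Tendsto (fun t : ℝ => C * (t ^ (-(1 - c)) * Real.log 2 +
        Real.log t / t ^ (1 - c))) Filter.atTop (nhds (C * (0 * Real.log 2 + 0))) :=
      (((tendsto_rpow_neg_atTop (by linarith)).mul_const _).add
        (isLittleO_log_rpow_atTop (by linarith)).tendsto_div_nhds_zero).const_mul C
    rw [zero_mul, add_zero, mul_zero] at h1
    exact h1.comp Real.tendsto_log_atTop
  have hne : ∀ X : ℝ, 3 ≤ X → Nonempty {S : Finset ℕ // (S.card : ℝ) ≤ Real.log X ^ c} :=
    fun X hX => ⟨⟨∅, by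
      have := Real.log_nonneg (show 1 ≤ X by linarith)
      simpa using Real.rpow_nonneg this c⟩⟩
  refine tendsto_of_tendsto_of_tendsto_of_le_of_le' tendsto_const_nhds hlim
    (Filter.Eventually.of_forall fun X => Real.iSup_nonneg fun S => gapProb_nonneg X S.1) ?_
  filter_upwards [Filter.eventually_ge_atTop 3] with X hX
  have hlog0 : 0 < Real.log X := Real.log_pos (by linarith)
  obtain ⟨-, hLL⟩ := half_le_log_log hX
  -- Since `3 ≤ X`, `log (3X) ≤ 2 log X`; the majorant then becomes a function of `log X` alone.
  have hLLle : Real.log (Real.log (3 * X)) ≤ Real.log 2 + Real.log (Real.log X) := by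
    rw [← Real.log_mul two_ne_zero hlog0.ne']
    refine Real.log_le_log (Real.log_pos (by linarith)) ?_
    rw [two_mul, ← Real.log_mul (by linarith) (by linarith)]
    exact Real.log_le_log (by linarith) (by gcongr)
  have := hne X hX
  refine ciSup_le fun S => ?_
  rw [gapProb_eq_filter]
  refine (hbound X hX _ fun h hh => (Finset.mem_filter.1 hh).2).trans ?_
  refine mul_le_mul_of_nonneg_left ?_ hC.le
  have hcard : (((S.1.filter fun h : ℕ => 1 ≤ h ∧ (h : ℝ) ≤ 2 * X).card : ℕ) : ℝ) ≤
      Real.log X ^ c := le_trans (by exact_mod_cast Finset.card_filter_le _ _) S.2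
  calc _ ≤ Real.log X ^ c * (Real.log 2 + Real.log (Real.log X)) / Real.log X := by gcongr
    _ = _ := by
        have h1 : Real.log X ^ (1 - c) = Real.log X / Real.log X ^ c := by
          rw [Real.rpow_sub hlog0, Real.rpow_one]
        have h2 : 0 < Real.log X ^ c := Real.rpow_pos_of_pos hlog0 c
        rw [Real.rpow_neg hlog0.le, h1]
        field_simp

end PrimeGaps

theorem mainTheorem2 :
    (∃ C : ℝ, 0 < C ∧ ∀ X : ℝ, 3 ≤ X → ∀ S : Finset ℕ,
      (∀ h ∈ S, 1 ≤ h ∧ (h : ℝ) ≤ 2 * X) →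
        PrimeGaps.gapProb X S ≤
          C * ((S.card : ℝ) * Real.log (Real.log (3 * X)) / Real.log X)) ∧
    (∀ c : ℝ, 0 < c → c < 1 → PrimeGaps.PSIW c) :=
  ⟨PrimeGaps.exists_gapProb_le, fun _ _ hc => PrimeGaps.psiw_of_lt_one hc⟩
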